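/- **Setting.** Let $d\ge 1$, let $\Omega\subset\mathbb{R}^d$ be open and bounded, and let $\Gamma\subset\Omega$ be finite and nonempty. Let $R=\min\{|x-y| : x,y\in\Gamma,\ x\ne y\}$ ($R=+\infty$ if $\Gamma$ is a single point). Let $\mu$ be a probability measure on $\Omega$ with density $\rho\in C^{1,1}(\overline\Omega)$ (differentiable with Lipschitz gradient), bounded above and below by positive constants. Let $\boldsymbol\eta:[0,\infty)\to[0,\infty)$ be nonincreasing and continuous at $0$, with $\boldsymbol\eta(t)\ge 1$ for $0\le t\le 1$ and $\boldsymbol\eta(t)=0$ for $t>2$. Set $\eta_\varepsilon(z)=\varepsilon^{-d}\boldsymbol\eta(|z|/\varepsilon)$ and $\sigma_\eta=\int_{\mathbb{R}^d}\boldsymbol\eta(|z|)\,z_1^2\,dz$. For $r_0>0$ and $\alpha\ge 0$ let $\gamma\in C^\infty(\overline\Omega\setminus\Gamma)$ satisfy $\gamma\ge 1$ on $\Omega\setminus\Gamma$ and $$\gamma(x)=1+\Big(\frac{r_0}{\operatorname{dist}(x,\Gamma)}\Big)^{\alpha}\quad\text{for } x\in\overline\Omega\setminus\Gamma \text{ with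 } \operatorname{dist}(x,\Gamma)\le R/4 .$$ Let $x_1,\dots,x_n$ be i.i.d. with law $\mu$, let $\mathcal X_n=\{x_1,\dots,x_n\}\cup\Gamma$, and let $$\mathcal L_{n,\varepsilon,\infty}u(x)=\frac{1}{2n\varepsilon^2}\sum_{y\in\mathcal X_n}(\gamma(x)+\gamma(y))\,\eta_\varepsilon(x-y)\,(u(y)-u(x)),$$ where $\gamma=\infty$ on $\Gamma$ and $\infty\cdot 0=0$. Write $\Delta_\rho\varphi=\rho^{-1}\operatorname{div}(\gamma\rho^2\nabla\varphi)$. For an open ball $B$ let $\|\varphi\|_{C^k(B)}=\sum_{j\le k}\sup_B|D^j\varphi|$, and let $C^3(B)$ be the space of three times continuously differentiable functions on $B$ with $\|\varphi\|_{C^3(B)}<\infty$. **Theorem.** There are constants $C,c>0$, depending only on $d,\Omega,\Gamma,\rho,\boldsymbol\eta,r_0,\alpha,\gamma$, such that the following holds for all $n\ge 1$ and all $0<\varepsilon\le\delta\le 1$. Let $D_{n,\varepsilon,\delta}$ be the event that $$\Big|\mathcal L_{n,\varepsilon,\infty}\varphi(x_i)-\tfrac12\sigma_\eta\,\Delta_\rho\varphi(x_i)\Big|\le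 C\Big((\varepsilon\beta_1+\varepsilon^2\beta_2)M^{-(\alpha+2)}+\varepsilon\beta_2M^{-(\alpha+1)}+\delta\beta_3M^{-\alpha}\Big)$$ holds for all $x_i$ with $2\varepsilon<\operatorname{dist}(x_i,\Gamma)\le R/4$ and $B(x_i,2\varepsilon)\subset\Omega$, and simultaneously for all $\varphi\in C^3(B(x_i,2\varepsilon))$, where $\beta_k=\|\varphi\|_{C^k(B(x_i,2\varepsilon))}$ and $M=\operatorname{dist}(x_i,\Gamma)-2\varepsilon$. Then $$\mathbb P(D_{n,\varepsilon,\delta})\ \ge\ 1-C\exp\big(-c\,\delta^2n\varepsilon^{d+2}+\log n\big),$$ in the sense that $D_{n,\varepsilon,\delta}$ contains a measurable event of at least this probability. -/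

import Mathlib

open MeasureTheory ProbabilityTheory Set
open scoped ENNReal NNReal ContDiff

noncomputable section

/-- Profile of the radial kernel: nonincreasing on `[0, ∞)`, continuous at `0`,
at least `1` on `[0, 1]` and zero on `(2, ∞)` (hence nonnegative on `[0, ∞)`).
Its values at negative arguments are never used. -/
structure IsKernelProfile (η : ℝ → ℝ) : Prop where
  antitone : AntitoneOn η (Ici 0)
  continuous_zero : ContinuousWithinAt η (Ici 0) 0
  one_le : ∀ t, 0 ≤ t → t ≤ 1 → 1 ≤ η t
  eq_zero : ∀ t, 2 < t → η t = 0

/-- The rescaled kernel `η_ε(z) = ε^{-d} η(|z| / ε)` on `ℝ^d`. -/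
def scaledKernel {d : ℕ} (η : ℝ → ℝ) (ε : ℝ) (z : EuclideanSpace ℝ (Fin d)) : ℝ :=
  1 / ε ^ d * η (‖z‖ / ε)

/-- `σ_η = ∫_{ℝ^d} η(|z|) z_1² dz`. -/
def kernelMoment (d : ℕ) [NeZero d] (η : ℝ → ℝ) : ℝ :=
  ∫ z : EuclideanSpace ℝ (Fin d), η ‖z‖ * z 0 ^ 2

/-- The region `dist(x, Γ) ≤ R / 4`, where `R` is the minimal distance between distinct points
of `Γ` (`R = ∞` if `Γ` is a single point, so that there is no restriction then). -/
def NearLabels {d : ℕ} (Γ : Finset (EuclideanSpace ℝ (Fin d)))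
    (x : EuclideanSpace ℝ (Fin d)) : Prop :=
  ENNReal.ofReal (Metric.infDist x Γ) ≤ (Γ : Set (EuclideanSpace ℝ (Fin d))).einfsep / 4

/-- `γ ∈ C^∞(closure Ω \ Γ)`, `γ ≥ 1` in `Ω`, and `γ = 1 + (r₀ / dist(·, Γ))^α` near `Γ`.
The value of `γ` on `Γ` (which is `∞` in the model) is left unspecified. -/
structure IsPenaltyWeight {d : ℕ} (Ω : Set (EuclideanSpace ℝ (Fin d)))
    (Γ : Finset (EuclideanSpace ℝ (Fin d))) (r₀ α : ℝ)
    (γ : EuclideanSpace ℝ (Fin d) → ℝ) : Prop where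
  smooth : ContDiffOn ℝ ∞ γ (closure Ω \ Γ)
  one_le : ∀ x ∈ Ω \ Γ, 1 ≤ γ x
  eq_near : ∀ x ∈ closure Ω \ Γ, NearLabels Γ x → γ x = 1 + (r₀ / Metric.infDist x Γ) ^ α

/-- The measure on `Ω` with Lebesgue density `ρ`. -/
def dataMeasure {d : ℕ} (Ω : Set (EuclideanSpace ℝ (Fin d)))
    (ρ : EuclideanSpace ℝ (Fin d) → ℝ) : Measure (EuclideanSpace ℝ (Fin d)) :=
  (volume.restrict Ω).withDensity fun x => ENNReal.ofReal (ρ x)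

/-- `ρ` is a probability density on the open set `Ω`, bounded above and below by positive
constants, of class `C^{1,1}` (differentiable with Lipschitz derivative). -/
structure IsDataDensity {d : ℕ} (Ω : Set (EuclideanSpace ℝ (Fin d)))
    (ρ : EuclideanSpace ℝ (Fin d) → ℝ) : Prop where
  bounds : ∃ a b : ℝ, 0 < a ∧ ∀ x ∈ Ω, a ≤ ρ x ∧ ρ x ≤ b
  differentiable : DifferentiableOn ℝ ρ Ω
  lipschitz : ∃ K : ℝ≥0, LipschitzOnWith K (fderiv ℝ ρ) Ω
  isProbability : IsProbabilityMeasure (dataMeasure Ω ρ)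

/-- The graph Laplacian `u ↦ (2 n ε²)⁻¹ ∑_{y ∈ V} (γ(x) + γ(y)) η_ε(x - y) (u(y) - u(x))`
with vertex set `V` and untruncated weight `γ`. At a vertex `x` with `dist(x, Γ) > 2 ε` the terms
with `y ∈ Γ` are zero, because `η_ε(x - y) = 0`: this is the convention `∞ · 0 = 0`. -/
def graphLaplacian {d : ℕ} (η : ℝ → ℝ) (γ : EuclideanSpace ℝ (Fin d) → ℝ) (n : ℕ) (ε : ℝ)
    (V : Finset (EuclideanSpace ℝ (Fin d))) (u : EuclideanSpace ℝ (Fin d) → ℝ)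
    (x : EuclideanSpace ℝ (Fin d)) : ℝ :=
  1 / (2 * n * ε ^ 2) * ∑ y ∈ V, (γ x + γ y) * scaledKernel η ε (x - y) * (u y - u x)

open Classical in
/-- The vertex set `{x_1, …, x_n} ∪ Γ`. -/
def vertices {d n : ℕ} (Γ : Finset (EuclideanSpace ℝ (Fin d)))
    (x : Fin n → EuclideanSpace ℝ (Fin d)) : Finset (EuclideanSpace ℝ (Fin d)) :=
  Finset.univ.image x ∪ Γ

/-- Divergence of a vector field, `∑ i, ∂_i F_i`. -/
def divergence {d : ℕ} (F : EuclideanSpace ℝ (Fin d) → EuclideanSpace ℝ (Fin d))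
    (x : EuclideanSpace ℝ (Fin d)) : ℝ :=
  ∑ i : Fin d, fderiv ℝ F x (EuclideanSpace.single i 1) i

/-- `Δ_ρ φ = ρ⁻¹ div(γ ρ² ∇φ)`. -/
def weightedLaplacian {d : ℕ} (γ ρ φ : EuclideanSpace ℝ (Fin d) → ℝ)
    (x : EuclideanSpace ℝ (Fin d)) : ℝ :=
  (ρ x)⁻¹ * divergence (fun y => (γ y * ρ y ^ 2) • gradient φ y) x

/-- The `C^k` norm on an open set `U`, with value `∞` allowed: the sum over `j ≤ k` of the
suprema over `U` of the norms of the `j`-th derivatives. -/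
def ckNorm {d : ℕ} (k : ℕ) (φ : EuclideanSpace ℝ (Fin d) → ℝ)
    (U : Set (EuclideanSpace ℝ (Fin d))) : ℝ≥0∞ :=
  ∑ j ∈ Finset.range (k + 1), ⨆ y ∈ U, ‖iteratedFDeriv ℝ j φ y‖ₑ

/-- `φ ∈ C³(U)` with finite `C³` norm, `U` open. -/
def IsTestFunction {d : ℕ} (φ : EuclideanSpace ℝ (Fin d) → ℝ)
    (U : Set (EuclideanSpace ℝ (Fin d))) : Prop :=
  ContDiffOn ℝ 3 φ U ∧ ckNorm 3 φ U ≠ ⊤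

/-- The right-hand side of the consistency estimate at the point `x`, without the constant:
`(ε β₁ + ε² β₂) M^{-(α+2)} + ε β₂ M^{-(α+1)} + δ β₃ M^{-α}`, where `β_k` is the `C^k` norm of `φ`
on the ball `B(x, 2ε)` and `M = dist(x, Γ) - 2ε`. -/
def consistencyError {d : ℕ} (Γ : Finset (EuclideanSpace ℝ (Fin d))) (α ε δ : ℝ)
    (φ : EuclideanSpace ℝ (Fin d) → ℝ) (x : EuclideanSpace ℝ (Fin d)) : ℝ :=
  let β : ℕ → ℝ := fun k => (ckNorm k φ (Metric.ball x (2 * ε))).toReal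
  let M : ℝ := Metric.infDist x Γ - 2 * ε
  (ε * β 1 + ε ^ 2 * β 2) * M ^ (-(α + 2)) + ε * β 2 * M ^ (-(α + 1)) + δ * β 3 * M ^ (-α)

/-- The configurations `(x_1, …, x_n)` for which the consistency estimate with constant `C` holds
at every `x_i` with `2ε < dist(x_i, Γ) ≤ R / 4` and `B(x_i, 2ε) ⊆ Ω`, and for every test function
on `B(x_i, 2ε)`. -/
def ConsistencyHolds {d : ℕ} [NeZero d] (Ω : Set (EuclideanSpace ℝ (Fin d)))
    (Γ : Finset (EuclideanSpace ℝ (Fin d))) (η : ℝ → ℝ) (γ ρ : EuclideanSpace ℝ (Fin d) → ℝ)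
    (α C : ℝ) (n : ℕ) (ε δ : ℝ) (x : Fin n → EuclideanSpace ℝ (Fin d)) : Prop :=
  ∀ i : Fin n, 2 * ε < Metric.infDist (x i) Γ → NearLabels Γ (x i) →
    Metric.ball (x i) (2 * ε) ⊆ Ω →
    ∀ φ : EuclideanSpace ℝ (Fin d) → ℝ, IsTestFunction φ (Metric.ball (x i) (2 * ε)) →
      |graphLaplacian η γ n ε (vertices Γ x) φ (x i)
          - 1 / 2 * kernelMoment d η * weightedLaplacian γ ρ φ (x i)|
        ≤ C * consistencyError Γ α ε δ φ (x i)

end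

/-! Write M = dist(x,Γ) - 2ε. Near Γ the weight γ is a shifted power of the distance, and elsewhere
it is smooth up to the boundary, so its derivatives of order j ≤ 2 are O(M^{-(α+j)}) on B(x,2ε)
(`IsPenaltyWeight.exists_bound`). All errors are measured in these powers.

Uniformity in φ comes from expanding φ to second order at x_i before any probability enters
(`abs_sum_localStatistic_sub_le`). Then φ appears only through its first two derivatives at x_i,
multiplied by the empirical moments with profiles z_k and z_k z_l. The remainder is at most ε³β₃
times the moment with profile 1, up to a constant. Only 1 + d + d² statistics have to concentrate,
and they do not depend on φ.

Normalised by M^α, each statistic is bounded uniformly in x and has variance O(ε^d). Bernstein's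
inequality for deviations of size δε^{d+1} therefore has exponent of order n(δε^{d+1})²/ε^d =
δ²nε^{d+2}, and the union over sample points contributes the factor n = e^{log n}
(`exists_const_deviation_le`).

For the expectations, (γ(x)+γ(y))ρ(y) is expanded at x, to first order for the moments z_k and to
zeroth order for z_k z_l (`abs_weight_sub_le`, `abs_integral_localStatistic_sub_le`). Radial
symmetry of the kernel kills odd moments and makes the second moment matrix σ_η times the identity.
What remains is ½σ_η(∇φ·(ρ∇γ + 2γ∇ρ) + γρΔφ), which is ½σ_ηΔ_ρφ. The biases have sizes εβ₁M^{-(α+2)}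
and εβ₂M^{-(α+1)}; the sampling errors and the Taylor remainder go into δβ₃M^{-α}
(`exists_const_consistencyHolds`). -/

/-! ### Bernstein's inequality for sums centred at a sample point. -/

section Concentration

variable {E : Type*} [MeasurableSpace E]

theorem integrable_of_measurable_of_bound {μ : Measure E} [IsFiniteMeasure μ] {h : E → ℝ}
    (hm : Measurable h) {K : ℝ} (hK : ∀ y, |h y| ≤ K) : Integrable h μ :=
  Integrable.of_bound hm.aestronglyMeasurable K (Filter.Eventually.of_forall hK)

/-- Bernstein's bound for the moment generating function of a bounded centred variable. -/
theorem integral_exp_mul_le_of_centered {μ : Measure E} [IsProbabilityMeasure μ] {h : E → ℝ}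
    (hm : Measurable h) {K V l : ℝ} (hK : ∀ y, |h y| ≤ K) (hV : ∫ y, h y ^ 2 ∂μ ≤ V)
    (h0 : ∫ y, h y ∂μ = 0) (hl : 0 ≤ l) (hlK : l * K ≤ 1) :
    ∫ y, Real.exp (l * h y) ∂μ ≤ Real.exp (l ^ 2 * V) := by
  have hi : Integrable h μ := integrable_of_measurable_of_bound hm hK
  have hi2 : Integrable (fun y => h y ^ 2) μ :=
    integrable_of_measurable_of_bound (hm.pow_const 2) (K := K ^ 2) fun y => by
      rw [abs_pow]; exact pow_le_pow_left₀ (abs_nonneg _) (hK y) 2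
  have hlh : ∀ y, |l * h y| ≤ 1 := fun y => by
    rw [abs_mul, abs_of_nonneg hl]
    exact (mul_le_mul_of_nonneg_left (hK y) hl).trans hlK
  have hie : Integrable (fun y => Real.exp (l * h y)) μ :=
    integrable_of_measurable_of_bound (hm.const_mul l).exp (K := Real.exp 1) fun y => by
      rw [Real.abs_exp]; exact Real.exp_le_exp.2 ((le_abs_self _).trans (hlh y))
  -- The elementary bound e^s ≤ 1 + s + s² for |s| ≤ 1; the linear term integrates to zero.
  have hb : ∀ y, Real.exp (l * h y) ≤ 1 + l * h y + l ^ 2 * h y ^ 2 := fun y => by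
    have := (abs_le.1 (Real.abs_exp_sub_one_sub_id_le (hlh y))).2
    nlinarith
  calc ∫ y, Real.exp (l * h y) ∂μ
      ≤ ∫ y, (1 + l * h y + l ^ 2 * h y ^ 2) ∂μ :=
        integral_mono hie (((integrable_const _).add (hi.const_mul l)).add (hi2.const_mul _)) hb
    _ = 1 + l ^ 2 * ∫ y, h y ^ 2 ∂μ := by
        have hA : Integrable (fun y => 1 + l * h y) μ := (integrable_const _).add (hi.const_mul l)
        rw [integral_add hA (hi2.const_mul _),
          integral_add (integrable_const _) (hi.const_mul l), integral_const_mul,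
          integral_const_mul, h0]
        simp
    _ ≤ 1 + l ^ 2 * V := by gcongr
    _ ≤ Real.exp (l ^ 2 * V) := by linarith [Real.add_one_le_exp (l ^ 2 * V)]

/-- Fubini isolates x_i. Once it is frozen, the other m coordinates are independent and the
exponential of the sum integrates to a product of m one-variable factors. -/
theorem integral_exp_sum_succAbove_le {μ : Measure E} [IsProbabilityMeasure μ] {h : E → E → ℝ}
    (hm : Measurable fun p : E × E => h p.1 p.2) {K V l : ℝ} (hK : ∀ x y, |h x y| ≤ K)
    (hV : ∀ x, ∫ y, h x y ^ 2 ∂μ ≤ V) (h0 : ∀ x, ∫ y, h x y ∂μ = 0) (hl : 0 ≤ l)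
    (hlK : l * K ≤ 1) (m : ℕ) (i : Fin (m + 1)) :
    ∫ x, Real.exp (l * ∑ j : Fin m, h (x i) (x (i.succAbove j))) ∂(Measure.pi fun _ => μ)
      ≤ Real.exp (m * (l ^ 2 * V)) := by
  have mp := measurePreserving_piFinSuccAbove (fun _ : Fin (m + 1) => μ) i
  have hGm : Measurable fun p : E × (Fin m → E) => Real.exp (l * ∑ j : Fin m, h p.1 (p.2 j)) := by
    refine Measurable.exp (Measurable.const_mul (Finset.measurable_sum _ fun j _ => ?_) l)
    exact hm.comp (measurable_fst.prodMk ((measurable_pi_apply j).comp measurable_snd))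
  have e1 : ∫ x, Real.exp (l * ∑ j : Fin m, h (x i) (x (i.succAbove j)))
        ∂(Measure.pi fun _ => μ)
      = ∫ p : E × (Fin m → E), Real.exp (l * ∑ j : Fin m, h p.1 (p.2 j))
        ∂(μ.prod (Measure.pi fun _ => μ)) := by
    rw [← mp.integral_comp' (fun p : E × (Fin m → E) => Real.exp (l * ∑ j : Fin m, h p.1 (p.2 j)))]
    rfl
  have hGi : Integrable (fun p : E × (Fin m → E) => Real.exp (l * ∑ j : Fin m, h p.1 (p.2 j)))
      (μ.prod (Measure.pi fun _ => μ)) := by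
    refine integrable_of_measurable_of_bound hGm (K := Real.exp m) fun p => ?_
    rw [Real.abs_exp, Finset.mul_sum]
    refine Real.exp_le_exp.2 ((Finset.sum_le_sum (g := fun _ => (1 : ℝ)) fun j _ => ?_).trans
      (by simp))
    exact (mul_le_mul_of_nonneg_left ((le_abs_self _).trans (hK _ _)) hl).trans hlK
  rw [e1, integral_prod _ hGi]
  have e2 : ∀ x, ∫ y : Fin m → E, Real.exp (l * ∑ j : Fin m, h x (y j)) ∂(Measure.pi fun _ => μ)
      ≤ Real.exp (m * (l ^ 2 * V)) := fun x => by
    have hmx : Measurable (h x) := hm.comp (measurable_const.prodMk measurable_id)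
    simp_rw [Finset.mul_sum, Real.exp_sum]
    rw [integral_fin_nat_prod_eq_prod (fun (_ : Fin m) y => Real.exp (l * h x y))]
    rw [Finset.prod_const, Finset.card_univ, Fintype.card_fin, Real.exp_nat_mul]
    exact pow_le_pow_left₀ (integral_nonneg fun _ => (Real.exp_pos _).le)
      (integral_exp_mul_le_of_centered hmx (hK x) (hV x) (h0 x) hl hlK) m
  calc _ ≤ ∫ _x : E, Real.exp (m * (l ^ 2 * V)) ∂μ :=
        integral_mono hGi.integral_prod_left (integrable_const _) e2
    _ = _ := by simp

/-- Bernstein's inequality for the sums `∑_{j ≠ i} h(x_i, x_j)` of an i.i.d. sample, where `h` is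
centred in its second argument. -/
theorem pi_real_sum_erase_ge_le {μ : Measure E} [IsProbabilityMeasure μ] {h : E → E → ℝ}
    (hm : Measurable fun p : E × E => h p.1 p.2) {K V l : ℝ} (hK : ∀ x y, |h x y| ≤ K)
    (hV : ∀ x, ∫ y, h x y ^ 2 ∂μ ≤ V) (h0 : ∀ x, ∫ y, h x y ∂μ = 0) (hl : 0 ≤ l)
    (hlK : l * K ≤ 1) (n : ℕ) (i : Fin n) (t : ℝ) :
    (Measure.pi fun _ : Fin n => μ).real {x | t ≤ ∑ j ∈ Finset.univ.erase i, h (x i) (x j)}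
      ≤ Real.exp (n * (l ^ 2 * V) - l * t) := by
  have hV0 : 0 ≤ V := by
    have : Nonempty E := nonempty_of_isProbabilityMeasure μ
    exact (integral_nonneg fun y => sq_nonneg _).trans (hV (Classical.arbitrary E))
  obtain ⟨m, rfl⟩ : ∃ m, n = m + 1 := ⟨n - 1, by have := i.2; omega⟩
  have hsum : ∀ x : Fin (m + 1) → E, ∑ j ∈ Finset.univ.erase i, h (x i) (x j)
      = ∑ j : Fin m, h (x i) (x (i.succAbove j)) := fun x => by
    have h1 := Finset.add_sum_erase Finset.univ (fun j => h (x i) (x j)) (Finset.mem_univ i)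
    have h2 := Fin.sum_univ_succAbove (fun j => h (x i) (x j)) i
    linarith
  simp_rw [hsum]
  have hGm : Measurable fun x : Fin (m + 1) → E =>
      ∑ j : Fin m, h (x i) (x (i.succAbove j)) :=
    Finset.measurable_sum _ fun j _ => hm.comp (f := fun x : Fin (m + 1) → E =>
      (x i, x (i.succAbove j))) ((measurable_pi_apply i).prodMk (measurable_pi_apply _))
  have hGi : Integrable (fun x : Fin (m + 1) → E =>
      Real.exp (l * ∑ j : Fin m, h (x i) (x (i.succAbove j)))) (Measure.pi fun _ => μ) := by
    refine integrable_of_measurable_of_bound (hGm.const_mul l).exp (K := Real.exp m) fun p => ?_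
    rw [Real.abs_exp, Finset.mul_sum]
    refine Real.exp_le_exp.2 ((Finset.sum_le_sum (g := fun _ => (1 : ℝ)) fun j _ => ?_).trans
      (by simp))
    exact (mul_le_mul_of_nonneg_left ((le_abs_self _).trans (hK _ _)) hl).trans hlK
  have hch := measure_ge_le_exp_mul_mgf (μ := Measure.pi fun _ : Fin (m + 1) => μ)
    (X := fun x => ∑ j : Fin m, h (x i) (x (i.succAbove j))) t hl hGi
  refine hch.trans ?_
  have := integral_exp_sum_succAbove_le hm hK hV h0 hl hlK m i
  calc _ ≤ Real.exp (-l * t) * Real.exp (m * (l ^ 2 * V)) := by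
        unfold mgf; gcongr
    _ ≤ _ := by
        rw [← Real.exp_add]
        refine Real.exp_le_exp.2 ?_
        have : 0 ≤ l ^ 2 * V := by positivity
        push_cast
        linarith

/-- Two-sided version of Bernstein's inequality for a kernel that is not centred, stated for the
bad event that some point of the sample has a large deviation. -/
theorem pi_real_exists_deviation_le {μ : Measure E} [IsProbabilityMeasure μ] {f : E → E → ℝ}
    (hm : Measurable fun p : E × E => f p.1 p.2) {K V l : ℝ} (hK : ∀ x y, |f x y| ≤ K)
    (hV : ∀ x, ∫ y, f x y ^ 2 ∂μ ≤ V) (hl : 0 ≤ l)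
    (hlK : l * (2 * K) ≤ 1) (n : ℕ) (t : ℝ) :
    (Measure.pi fun _ : Fin n => μ).real
        {x | ∃ i, t ≤ |∑ j ∈ Finset.univ.erase i, (f (x i) (x j) - ∫ y, f (x i) y ∂μ)|}
      ≤ 2 * n * Real.exp (n * (l ^ 2 * V) - l * t) := by
  set g : E → ℝ := fun x => ∫ y, f x y ∂μ with hg
  have hgm : Measurable g := (hm.stronglyMeasurable.integral_prod_right).measurable
  have hfx : ∀ x, Measurable (f x) := fun x => hm.comp (measurable_const.prodMk measurable_id)
  have hfi : ∀ x, Integrable (f x) μ := fun x => integrable_of_measurable_of_bound (hfx x) (hK x)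
  have hgK : ∀ x, |g x| ≤ K := fun x => by
    have := norm_integral_le_of_norm_le_const (μ := μ) (f := f x) (C := K)
      (Filter.Eventually.of_forall (hK x))
    simpa using this
  have hhm : Measurable fun p : E × E => f p.1 p.2 - g p.1 :=
    hm.sub (hgm.comp measurable_fst)
  have hhK : ∀ x y, |f x y - g x| ≤ 2 * K := fun x y =>
    (abs_sub _ _).trans (by linarith [hK x y, hgK x])
  have hh0 : ∀ x, ∫ y, (f x y - g x) ∂μ = 0 := fun x => by
    rw [integral_sub (hfi x) (integrable_const _)]; simp [hg]
  have hhV : ∀ x, ∫ y, (f x y - g x) ^ 2 ∂μ ≤ V := fun x => by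
    have hi2 : Integrable (fun y => f x y ^ 2) μ :=
      integrable_of_measurable_of_bound ((hfx x).pow_const 2) (K := K ^ 2) fun y => by
        rw [abs_pow]; exact pow_le_pow_left₀ (abs_nonneg _) (hK x y) 2
    have : ∫ y, (f x y - g x) ^ 2 ∂μ = ∫ y, f x y ^ 2 ∂μ - g x ^ 2 := by
      have e : (fun y => (f x y - g x) ^ 2)
          = fun y => f x y ^ 2 - 2 * g x * f x y + g x ^ 2 := by ext; ring
      have hA : Integrable (fun y => f x y ^ 2 - 2 * g x * f x y) μ :=
        hi2.sub ((hfi x).const_mul _)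
      rw [e, integral_add hA (integrable_const _),
        integral_sub hi2 ((hfi x).const_mul _), integral_const_mul]
      simp only [integral_const, probReal_univ, smul_eq_mul, one_mul]
      change _ - 2 * g x * g x + _ = _
      ring
    linarith [hV x, sq_nonneg (g x)]
  have h1 := fun i => pi_real_sum_erase_ge_le (μ := μ) (h := fun x y => f x y - g x) hhm hhK hhV hh0
    hl hlK n i t
  have h2 := fun i => pi_real_sum_erase_ge_le (μ := μ) (h := fun x y => -(f x y - g x)) hhm.neg
    (fun x y => by rw [abs_neg]; exact hhK x y) (V := V) (fun x => by simp_rw [neg_sq]; exact hhV x)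
    (fun x => by rw [integral_neg, hh0, neg_zero]) hl hlK n i t
  calc _ ≤ (Measure.pi fun _ : Fin n => μ).real (⋃ i : Fin n,
          ({x | t ≤ ∑ j ∈ Finset.univ.erase i, (f (x i) (x j) - g (x i))} ∪
          {x | t ≤ ∑ j ∈ Finset.univ.erase i, -(f (x i) (x j) - g (x i))})) := by
        refine measureReal_mono ?_ (measure_ne_top _ _)
        rintro x ⟨i, hi⟩
        refine mem_iUnion.2 ⟨i, ?_⟩
        rcases le_abs.1 hi with h | h
        · exact Or.inl h
        · refine Or.inr ?_
          rw [mem_ofPred_eq, Finset.sum_neg_distrib]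
          exact h
    _ ≤ ∑ i : Fin n, (Measure.pi fun _ : Fin n => μ).real
          ({x | t ≤ ∑ j ∈ Finset.univ.erase i, (f (x i) (x j) - g (x i))} ∪
          {x | t ≤ ∑ j ∈ Finset.univ.erase i, -(f (x i) (x j) - g (x i))}) :=
        measureReal_iUnion_fintype_le _
    _ ≤ ∑ _i : Fin n, 2 * Real.exp (n * (l ^ 2 * V) - l * t) := by
        refine Finset.sum_le_sum fun i _ => (measureReal_union_le _ _).trans ?_
        linarith [h1 i, h2 i]
    _ = _ := by simp; ring

/-- Two points of an i.i.d. sample almost surely avoid a relation with null sections. -/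
theorem ae_pi_pairwise_of_sections {μ : Measure E} [IsProbabilityMeasure μ] {r : Set (E × E)}
    (hr : MeasurableSet r) (h0 : ∀ x, μ {y | (x, y) ∈ r} = 0) (n : ℕ) :
    ∀ᵐ x ∂(Measure.pi fun _ : Fin n => μ), ∀ i j, i ≠ j → (x i, x j) ∉ r := by
  refine ae_all_iff.2 fun i => ae_all_iff.2 fun j => ?_
  by_cases hij : i = j
  · simp [hij]
  obtain ⟨m, rfl⟩ : ∃ m, n = m + 1 := ⟨n - 1, by have := i.2; omega⟩
  obtain ⟨k, rfl⟩ := Fin.exists_succAbove_eq (Ne.symm hij)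
  have mp := measurePreserving_piFinSuccAbove (fun _ : Fin (m + 1) => μ) i
  have mp2 : MeasurePreserving (Function.eval k) (Measure.pi fun _ : Fin m => μ) μ :=
    measurePreserving_eval (fun _ : Fin m => μ) k
  -- The pair of coordinates has law μ ⊗ μ, under which a set with null sections is null.
  have mp3 := ((MeasurePreserving.id μ).prod mp2).comp mp
  have hr0 : (μ.prod μ) r = 0 := by
    rw [Measure.prod_apply hr]
    exact (lintegral_congr h0).trans (by simp)
  have := mp3.quasiMeasurePreserving.preimage_null hr0
  rw [ae_iff]
  refine measure_mono_null (fun x hx => ?_) this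
  simp only [mem_ofPred_eq, not_forall, not_not] at hx
  exact hx.2

end Concentration

/-! ### Derivatives of the singular weight. -/

section WeightBounds

open Filter Topology

/-- Meant for s = closure Ω \ Γ, which need not be open, so `iteratedFDeriv` is not controlled at
boundary points. Near each point of k there is a local Taylor series, continuous relative to s and
hence locally bounded; on the open set o it coincides with the true derivatives. Compactness of k
makes the bound uniform. -/
theorem exists_bound_iteratedFDeriv_of_isCompact {E : Type*} [NormedAddCommGroup E]
    [NormedSpace ℝ E] {f : E → ℝ} {s k o : Set E} {m : ℕ} (hf : ContDiffOn ℝ m f s)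
    (hk : IsCompact k) (hks : k ⊆ s) (ho : IsOpen o) (hos : o ⊆ s) :
    ∃ K, ∀ y ∈ k ∩ o, ∀ j ≤ m, ‖iteratedFDeriv ℝ j f y‖ ≤ K := by
  refine hk.induction_on (p := fun t => ∃ K, ∀ y ∈ t ∩ o, ∀ j ≤ m, ‖iteratedFDeriv ℝ j f y‖ ≤ K)
    ⟨0, by simp⟩ ?_ ?_ ?_
  · rintro t u htu ⟨K, hK⟩
    exact ⟨K, fun y hy => hK y ⟨htu hy.1, hy.2⟩⟩
  · rintro t u ⟨K, hK⟩ ⟨K', hK'⟩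
    refine ⟨max K K', fun y hy j hj => ?_⟩
    rcases hy.1 with h | h
    · exact (hK y ⟨h, hy.2⟩ j hj).trans (le_max_left _ _)
    · exact (hK' y ⟨h, hy.2⟩ j hj).trans (le_max_right _ _)
  · intro x hx
    have hxs := hks hx
    obtain ⟨u, hu, p, hp⟩ := contDiffWithinAt_nat.1 (hf x hxs)
    rw [insert_eq_of_mem hxs] at hu
    obtain ⟨v, hvo, hxv, hvu⟩ := mem_nhdsWithin.1 hu
    have hxu : x ∈ u := hvu ⟨hxv, hxs⟩
    have h1 : ∀ᶠ y in 𝓝[u] x, ∀ j ∈ Finset.range (m + 1), ‖p y j‖ < ‖p x j‖ + 1 := by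
      rw [Filter.eventually_all_finset]
      intro j hj
      have hc := (hp.cont j (by exact_mod_cast Nat.lt_succ_iff.1 (Finset.mem_range.1 hj))) x hxu
      exact hc.norm.eventually_lt_const (by linarith)
    have h2 : ∀ᶠ y in 𝓝[k] x, ∀ j ∈ Finset.range (m + 1), ‖p y j‖ < ‖p x j‖ + 1 :=
      (h1.filter_mono (nhdsWithin_le_of_mem hu)).filter_mono (nhdsWithin_mono x hks)
    have h3 : ∀ᶠ y in 𝓝[k] x, y ∈ v := mem_nhdsWithin_of_mem_nhds (hvo.mem_nhds hxv)
    refine ⟨_, h2.and h3, ∑ j ∈ Finset.range (m + 1), (‖p x j‖ + 1), ?_⟩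
    rintro y ⟨⟨hy, hyv⟩, hyo⟩ j hj
    have hj' : j ∈ Finset.range (m + 1) := Finset.mem_range.2 (Nat.lt_succ_of_le hj)
    have hov : IsOpen (v ∩ o) := hvo.inter ho
    have hpo := hp.mono (show v ∩ o ⊆ u from fun z hz => hvu ⟨hz.1, hos hz.2⟩)
    have he := hpo.eq_iteratedFDerivWithin_of_uniqueDiffOn (m := j) (by exact_mod_cast hj)
      hov.uniqueDiffOn ⟨hyv, hyo⟩
    rw [iteratedFDerivWithin_of_isOpen j hov ⟨hyv, hyo⟩] at he
    rw [← he]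
    exact (hy j hj').le.trans (Finset.single_le_sum (f := fun j => ‖p x j‖ + 1)
      (fun i _ => by positivity) hj')

variable {E : Type*} [NormedAddCommGroup E] [InnerProductSpace ℝ E]

/-- The squared norm is smooth, so powers of the distance are written as powers of it. The
parameters are general because the second derivative reuses the formula with exponent s - 1. -/
theorem hasFDerivAt_norm_sub_sq_rpow (c a s : ℝ) {p z : E} (hz : z ≠ p) :
    HasFDerivAt (fun z => c + a * (‖z - p‖ ^ 2) ^ s)
      ((a * (2 * s) * (‖z - p‖ ^ 2) ^ (s - 1)) • (innerSL ℝ (z - p) : E →L[ℝ] ℝ)) z := by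
  have h0 : ‖z - p‖ ^ 2 ≠ 0 := pow_ne_zero 2 (norm_ne_zero_iff.2 (sub_ne_zero.2 hz))
  have h1 : HasFDerivAt (fun z => z - p) (ContinuousLinearMap.id ℝ E) z :=
    (hasFDerivAt_id z).sub_const p
  have h2 := (((h1.norm_sq).rpow_const (p := s) (Or.inl h0)).const_mul a).const_add c
  refine h2.congr_fderiv ?_
  ext v
  simp
  ring

theorem norm_fderiv_norm_sub_sq_rpow_le (c a s : ℝ) {p z : E} (hz : z ≠ p) :
    ‖fderiv ℝ (fun z => c + a * (‖z - p‖ ^ 2) ^ s) z‖ ≤ 2 * |a| * |s| * ‖z - p‖ ^ (2 * s - 1) := by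
  have h0 : 0 < ‖z - p‖ := norm_pos_iff.2 (sub_ne_zero.2 hz)
  rw [(hasFDerivAt_norm_sub_sq_rpow c a s hz).fderiv, norm_smul, innerSL_apply_norm,
    Real.norm_eq_abs, abs_mul, abs_mul, abs_mul, abs_two,
    abs_of_nonneg (Real.rpow_nonneg (sq_nonneg _) _), ← Real.rpow_natCast, ← Real.rpow_mul h0.le]
  have : ‖z - p‖ ^ (2 * s - 1) = ‖z - p‖ ^ (((2 : ℕ) : ℝ) * (s - 1)) * ‖z - p‖ := by
    rw [← Real.rpow_add_one h0.ne']; congr 1; push_cast; ring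
  rw [this]
  apply le_of_eq; ring

theorem norm_fderiv_fderiv_norm_sub_sq_rpow_le (c a s : ℝ) {p z : E} (hz : z ≠ p) :
    ‖fderiv ℝ (fderiv ℝ (fun z => c + a * (‖z - p‖ ^ 2) ^ s)) z‖
      ≤ 2 * |a| * |s| * (1 + 2 * |s - 1|) * ‖z - p‖ ^ (2 * s - 2) := by
  have h0 : 0 < ‖z - p‖ := norm_pos_iff.2 (sub_ne_zero.2 hz)
  have he : fderiv ℝ (fun z => c + a * (‖z - p‖ ^ 2) ^ s) =ᶠ[𝓝 z]
      fun z => (0 + a * (2 * s) * (‖z - p‖ ^ 2) ^ (s - 1)) • (innerSL ℝ (z - p) : E →L[ℝ] ℝ) := by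
    filter_upwards [isOpen_ne.mem_nhds hz] with y hy
    rw [(hasFDerivAt_norm_sub_sq_rpow c a s hy).fderiv, zero_add]
  obtain ⟨B, hBv, hn⟩ : ∃ B : E →L[ℝ] E →L[ℝ] ℝ, (∀ v, B v = innerSL ℝ v) ∧ ‖B‖ ≤ 1 :=
    ⟨innerSL ℝ, fun v => rfl, norm_innerSL_le ℝ⟩
  have hB : HasFDerivAt (fun z => (innerSL ℝ (z - p) : E →L[ℝ] ℝ)) B z := by
    have h1 : HasFDerivAt (fun z => z - p) (ContinuousLinearMap.id ℝ E) z :=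
      (hasFDerivAt_id z).sub_const p
    simp_rw [← hBv]
    exact B.hasFDerivAt.comp z h1
  have hA := hasFDerivAt_norm_sub_sq_rpow 0 (a * (2 * s)) (s - 1) hz
  have hd := (hA.smul hB).fderiv
  rw [he.fderiv_eq]
  change ‖fderiv ℝ ((fun z => 0 + a * (2 * s) * (‖z - p‖ ^ 2) ^ (s - 1)) •
    fun z => (innerSL ℝ (z - p) : E →L[ℝ] ℝ)) z‖ ≤ _
  rw [hd]
  have e1 : (‖z - p‖ ^ 2) ^ (s - 1) = ‖z - p‖ ^ (2 * s - 2) := by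
    rw [← Real.rpow_natCast, ← Real.rpow_mul h0.le]; congr 1; push_cast; ring
  have e2 : (‖z - p‖ ^ 2) ^ (s - 1 - 1) * ‖z - p‖ * ‖z - p‖ = ‖z - p‖ ^ (2 * s - 2) := by
    rw [← Real.rpow_natCast, ← Real.rpow_mul h0.le, ← Real.rpow_add_one h0.ne',
      ← Real.rpow_add_one h0.ne']; congr 1; push_cast; ring
  refine (norm_add_le (E := E →L[ℝ] E →L[ℝ] ℝ) _ _).trans ?_
  refine (add_le_add_left (ContinuousLinearMap.opNorm_smul_le _ B) _).trans ?_
  rw [ContinuousLinearMap.norm_smulRight_apply, norm_smul, innerSL_apply_norm,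
    zero_add, Real.norm_eq_abs, Real.norm_eq_abs]
  simp only [abs_mul, abs_two]
  rw [abs_of_nonneg (Real.rpow_nonneg (sq_nonneg ‖z - p‖) (s - 1)),
    abs_of_nonneg (Real.rpow_nonneg (sq_nonneg ‖z - p‖) (s - 1 - 1)), e1]
  have hp : 0 ≤ |a| * (2 * |s|) * ‖z - p‖ ^ (2 * s - 2) := by positivity
  calc |a| * (2 * |s|) * ‖z - p‖ ^ (2 * s - 2) * ‖B‖
        + |a| * (2 * |s|) * (2 * |s - 1|) * (‖z - p‖ ^ 2) ^ (s - 1 - 1) * ‖z - p‖ * ‖z - p‖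
      ≤ |a| * (2 * |s|) * ‖z - p‖ ^ (2 * s - 2) * 1 + |a| * (2 * |s|) * (2 * |s - 1|) *
          ((‖z - p‖ ^ 2) ^ (s - 1 - 1) * ‖z - p‖ * ‖z - p‖) := by
        refine add_le_add (mul_le_mul_of_nonneg_left hn hp) (le_of_eq ?_)
        ring
    _ = _ := by rw [e2]; ring

theorem norm_iteratedFDeriv_two (f : E → ℝ) (x : E) :
    ‖iteratedFDeriv ℝ 2 f x‖ = ‖fderiv ℝ (fderiv ℝ f) x‖ := by
  rw [← norm_iteratedFDeriv_one, norm_iteratedFDeriv_fderiv]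

/-- Derivatives of order at most two of `1 + (r₀ / |· - p|)^α` near the pole `p`. -/
theorem norm_iteratedFDeriv_pole_le {r₀ α : ℝ} (hr₀ : 0 < r₀) (hα : 0 ≤ α) {p z : E}
    (hz : z ≠ p) (hz1 : ‖z - p‖ ≤ 1) {f : E → ℝ}
    (hf : f =ᶠ[𝓝 z] fun y => 1 + (r₀ / ‖y - p‖) ^ α) {j : ℕ} (hj : j ≤ 2) :
    ‖iteratedFDeriv ℝ j f z‖
      ≤ (1 + r₀ ^ α * (1 + α) * (3 + α)) * ‖z - p‖ ^ (-(α + j)) := by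
  have h0 : 0 < ‖z - p‖ := norm_pos_iff.2 (sub_ne_zero.2 hz)
  have hpos : ∀ s : ℝ, 0 < ‖z - p‖ ^ s := fun s => Real.rpow_pos_of_pos h0 s
  have hrp : 0 < r₀ ^ α := Real.rpow_pos_of_pos hr₀ α
  have hf' : f =ᶠ[𝓝 z] fun y => 1 + r₀ ^ α * (‖y - p‖ ^ 2) ^ (-α / 2) := by
    filter_upwards [hf] with y hy
    rw [hy, Real.div_rpow hr₀.le (norm_nonneg _), ← Real.rpow_natCast,
      ← Real.rpow_mul (norm_nonneg _), div_eq_mul_inv, ← Real.rpow_neg (norm_nonneg _)]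
    congr 3; push_cast; ring
  have hs : |(-α / 2)| = α / 2 := by rw [abs_div, abs_neg, abs_of_nonneg hα, abs_two]
  have ha : |r₀ ^ α| = r₀ ^ α := abs_of_pos hrp
  rw [(hf'.iteratedFDeriv ℝ j).eq_of_nhds]
  -- One constant serves all orders; the exact factors of r₀^α for orders one and two are α and α(3
  -- + α).
  have key : ∀ A B s : ℝ, A ≤ r₀ ^ α * B * ‖z - p‖ ^ s → B ≤ (1 + α) * (3 + α) →
      A ≤ (1 + r₀ ^ α * (1 + α) * (3 + α)) * ‖z - p‖ ^ s := fun A B s h1 h2 => by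
    refine h1.trans (mul_le_mul_of_nonneg_right ?_ (hpos s).le)
    nlinarith [mul_le_mul_of_nonneg_left h2 hrp.le]
  interval_cases j
  · rw [norm_iteratedFDeriv_zero, Real.norm_eq_abs, ← Real.rpow_natCast, ← Real.rpow_mul h0.le]
    have e : ((2 : ℕ) : ℝ) * (-α / 2) = -(α + (0 : ℕ)) := by push_cast; ring
    rw [e, abs_of_pos (by have := hpos (-(α + (0 : ℕ))); positivity)]
    have h1 : 1 ≤ ‖z - p‖ ^ (-(α + (0 : ℕ))) :=
      Real.one_le_rpow_of_pos_of_le_one_of_nonpos h0 hz1 (by simpa using hα)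
    have h2 : r₀ ^ α ≤ r₀ ^ α * (1 + α) * (3 + α) := by
      rw [mul_assoc]; exact le_mul_of_one_le_right hrp.le (by nlinarith)
    nlinarith
  · rw [norm_iteratedFDeriv_one]
    have h := norm_fderiv_norm_sub_sq_rpow_le 1 (r₀ ^ α) (-α / 2) hz
    rw [hs, ha, show 2 * (-α / 2) - 1 = -(α + (1 : ℕ)) by push_cast; ring] at h
    exact key _ α _ (h.trans_eq (by ring)) (by nlinarith)
  · rw [norm_iteratedFDeriv_two]
    have h := norm_fderiv_fderiv_norm_sub_sq_rpow_le 1 (r₀ ^ α) (-α / 2) hz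
    have h3 : |-α / 2 - 1| = α / 2 + 1 := by
      rw [← abs_neg, abs_of_nonneg (by linarith)]; ring
    rw [hs, ha, h3, show 2 * (-α / 2) - 2 = -(α + (2 : ℕ)) by push_cast; ring] at h
    exact key _ (α * (3 + α)) _ (h.trans_eq (by ring)) (by nlinarith)

/-- The radius is min(R/4, 1). A label p closer than r to x remains the nearest one for y near x,
since every other label is at distance at least 4r from p; so the distance to Γ is locally ‖y - p‖.
The cap at 1 keeps r finite when Γ is a single point and lets a negative power of the distance
absorb the constant 1 in γ. -/
theorem exists_nearLabels_radius {d : ℕ} (Γ : Finset (EuclideanSpace ℝ (Fin d)))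
    (hΓ : Γ.Nonempty) :
    ∃ r : ℝ, 0 < r ∧ r ≤ 1 ∧ ∀ x, Metric.infDist x Γ < r → NearLabels Γ x ∧
      ∃ p ∈ Γ, ∀ᶠ y in 𝓝 x, Metric.infDist y Γ = ‖y - p‖ ∧ Metric.infDist y Γ < r := by
  have h0 : 0 < (Γ : Set (EuclideanSpace ℝ (Fin d))).einfsep := Γ.finite_toSet.einfsep_pos
  set e := min ((Γ : Set (EuclideanSpace ℝ (Fin d))).einfsep / 4) 1 with he
  have he0 : 0 < e := lt_min (ENNReal.div_pos h0.ne' (by simp)) one_pos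
  have het : e ≠ ⊤ := ((min_le_right _ _).trans_lt ENNReal.one_lt_top).ne
  refine ⟨e.toReal, ENNReal.toReal_pos he0.ne' het, ?_, fun x hx => ⟨?_, ?_⟩⟩
  · exact ENNReal.toReal_mono (by simp) (min_le_right _ _)
  · exact (ENNReal.ofReal_le_of_le_toReal hx.le).trans (min_le_left _ _)
  · have hne : (Γ : Set (EuclideanSpace ℝ (Fin d))).Nonempty := hΓ
    obtain ⟨p, hp, hxp⟩ := (Metric.infDist_lt_iff hne).1 hx
    refine ⟨p, hp, ?_⟩
    filter_upwards [Metric.isOpen_ball.mem_nhds (Metric.mem_ball.2 hxp)] with y hy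
    have hyp : dist y p < e.toReal := hy
    have h1 : Metric.infDist y Γ ≤ dist y p := Metric.infDist_le_dist_of_mem hp
    refine ⟨?_, h1.trans_lt hyp⟩
    rw [← dist_eq_norm]
    refine le_antisymm h1 ((Metric.le_infDist hne).2 fun q hq => ?_)
    by_cases hpq : p = q
    · rw [hpq]
    have h2 : e ≤ (Γ : Set (EuclideanSpace ℝ (Fin d))).einfsep / 4 := min_le_left _ _
    have h3 : 4 * e ≤ edist p q := by
      refine le_trans ?_ (einfsep_le_edist_of_mem hp hq hpq)
      rw [mul_comm]
      exact (ENNReal.le_div_iff_mul_le (by simp) (by simp)).1 h2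
    have h4 : 4 * e.toReal ≤ dist p q := by
      rw [edist_dist] at h3
      have := ENNReal.toReal_mono ENNReal.ofReal_ne_top h3
      rwa [ENNReal.toReal_mul, ENNReal.toReal_ofReal dist_nonneg] at this
    have := dist_triangle_left p q y
    have := ENNReal.toReal_pos he0.ne' het
    linarith

theorem isOpen_diff_finset {d : ℕ} {Ω : Set (EuclideanSpace ℝ (Fin d))} (hΩ : IsOpen Ω)
    (Γ : Finset (EuclideanSpace ℝ (Fin d))) : IsOpen (Ω \ Γ) :=
  hΩ.sdiff Γ.finite_toSet.isClosed

theorem IsPenaltyWeight.contDiffAt {d : ℕ} {Ω : Set (EuclideanSpace ℝ (Fin d))} (hΩ : IsOpen Ω)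
    {Γ : Finset (EuclideanSpace ℝ (Fin d))} {r₀ α : ℝ} {γ : EuclideanSpace ℝ (Fin d) → ℝ}
    (hγ : IsPenaltyWeight Ω Γ r₀ α γ) {y : EuclideanSpace ℝ (Fin d)} (hy : y ∈ Ω \ Γ) :
    ContDiffAt ℝ ∞ γ y :=
  hγ.smooth.contDiffAt (Filter.mem_of_superset ((isOpen_diff_finset hΩ Γ).mem_nhds hy)
    (sdiff_subset_sdiff_left subset_closure))

/-- The derivative of order `j ≤ 2` of the weight is at most of size `dist(·, Γ)^{-(α+j)}`. -/
theorem IsPenaltyWeight.exists_bound {d : ℕ} {Ω : Set (EuclideanSpace ℝ (Fin d))} (hΩ : IsOpen Ω)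
    (hΩb : Bornology.IsBounded Ω) {Γ : Finset (EuclideanSpace ℝ (Fin d))} (hΓne : Γ.Nonempty)
    (hΓ : (Γ : Set (EuclideanSpace ℝ (Fin d))) ⊆ Ω)
    {r₀ α : ℝ} (hr₀ : 0 < r₀) (hα : 0 ≤ α) {γ : EuclideanSpace ℝ (Fin d) → ℝ}
    (hγ : IsPenaltyWeight Ω Γ r₀ α γ) :
    ∃ K : ℝ, 0 < K ∧ ∀ y ∈ Ω \ Γ, ∀ j ≤ 2,
      ‖iteratedFDeriv ℝ j γ y‖ ≤ K * Metric.infDist y Γ ^ (-(α + j)) := by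
  have hne : (Γ : Set (EuclideanSpace ℝ (Fin d))).Nonempty := hΓne
  obtain ⟨r, hr, hr1, hnear⟩ := exists_nearLabels_radius Γ hΓne
  obtain ⟨D, hD1, hD⟩ : ∃ D : ℝ, 1 ≤ D ∧ ∀ y ∈ Ω, Metric.infDist y Γ ≤ D := by
    obtain ⟨D, hD⟩ := Metric.isBounded_iff.1 hΩb
    obtain ⟨p, hp⟩ := hne
    exact ⟨max 1 D, le_max_left _ _, fun y hy =>
      (Metric.infDist_le_dist_of_mem hp).trans ((hD hy (hΓ hp)).trans (le_max_right _ _))⟩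
  have hcpt : IsCompact (closure Ω ∩ {y | r ≤ Metric.infDist y Γ}) :=
    (hΩb.isCompact_closure).inter_right
      (isClosed_le continuous_const (Metric.continuous_infDist_pt _))
  have hzero : ∀ y ∈ (Γ : Set (EuclideanSpace ℝ (Fin d))), Metric.infDist y Γ = 0 :=
    fun y hy => Metric.infDist_zero_of_mem hy
  obtain ⟨K, hK⟩ := exists_bound_iteratedFDeriv_of_isCompact (m := 2) (o := Ω \ Γ)
    (contDiffOn_infty.1 hγ.smooth 2) hcpt
    (fun y hy => ⟨hy.1, fun hyΓ => by
      have h2 : r ≤ Metric.infDist y Γ := hy.2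
      rw [hzero y hyΓ] at h2; linarith⟩)
    (isOpen_diff_finset hΩ Γ) (sdiff_subset_sdiff_left subset_closure)
  have hrp : 0 < r₀ ^ α := Real.rpow_pos_of_pos hr₀ α
  have hK0 : 0 < |K| * D ^ (α + 2) + (1 + r₀ ^ α * (1 + α) * (3 + α)) := by positivity
  refine ⟨_, hK0, fun y hy j hj => ?_⟩
  have hd0 : 0 < Metric.infDist y Γ :=
    (Γ.finite_toSet.isClosed.notMem_iff_infDist_pos hne).1 hy.2
  have hdp := Real.rpow_pos_of_pos hd0 (-(α + j))
  rcases lt_or_ge (Metric.infDist y Γ) r with h | h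
  · obtain ⟨p, hp, hev⟩ := (hnear y h).2
    have hyp := hev.self_of_nhds.1
    have hyne : y ≠ p := fun e => hy.2 (e ▸ hp)
    have hf : γ =ᶠ[𝓝 y] fun z => 1 + (r₀ / ‖z - p‖) ^ α := by
      filter_upwards [hev, (isOpen_diff_finset hΩ Γ).mem_nhds hy] with z hz hzΩ
      rw [hγ.eq_near z ⟨subset_closure hzΩ.1, hzΩ.2⟩ (hnear z hz.2).1, hz.1]
    have := norm_iteratedFDeriv_pole_le hr₀ hα hyne (by rw [← hyp]; linarith) hf hj
    rw [← hyp] at this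
    refine this.trans (mul_le_mul_of_nonneg_right ?_ hdp.le)
    have : 0 ≤ |K| * D ^ (α + 2) := by positivity
    linarith
  · have h1 := hK y ⟨⟨subset_closure hy.1, h⟩, hy⟩ j hj
    -- Away from Γ the derivatives are merely bounded; since the distance is at most D, a constant
    -- is dominated by D^{α+2} times the required negative power.
    have h2 : 1 ≤ D ^ (α + 2) * Metric.infDist y Γ ^ (-(α + j)) := by
      rw [Real.rpow_neg hd0.le, ← div_eq_mul_inv, one_le_div (Real.rpow_pos_of_pos hd0 _)]
      calc Metric.infDist y Γ ^ (α + j) ≤ D ^ (α + j) :=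
            Real.rpow_le_rpow hd0.le (hD y hy.1) (by positivity)
        _ ≤ D ^ (α + 2) := Real.rpow_le_rpow_of_exponent_le hD1 (by
            have : (j : ℝ) ≤ 2 := by exact_mod_cast hj
            linarith)
    calc _ ≤ |K| * 1 := by rw [mul_one]; exact h1.trans (le_abs_self K)
      _ ≤ |K| * (D ^ (α + 2) * Metric.infDist y Γ ^ (-(α + j))) := by gcongr
      _ ≤ _ := by
        rw [add_mul, mul_assoc]
        have : 0 ≤ (1 + r₀ ^ α * (1 + α) * (3 + α)) * Metric.infDist y Γ ^ (-(α + j)) := by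
          positivity
        linarith

end WeightBounds

/-! ### Taylor estimates on convex sets. -/

section Taylor

variable {E : Type*} [NormedAddCommGroup E] [NormedSpace ℝ E]
  {F : Type*} [NormedAddCommGroup F] [NormedSpace ℝ F]

/-- Mean value inequality on the segment, applied to f minus its linear part. No factorial is
gained, but m = 1 and m = 2 give the first- and second-order remainders. -/
theorem norm_taylor_one_le {f : E → F} {f' : E → E →L[ℝ] F} {U : Set E} (hU : Convex ℝ U)
    (hf : ∀ z ∈ U, HasFDerivAt f (f' z) z) {K : ℝ} (hK : 0 ≤ K) (m : ℕ) {x y : E} (hx : x ∈ U)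
    (hy : y ∈ U) (hb : ∀ z ∈ U, ‖f' z - f' x‖ ≤ K * ‖z - x‖ ^ m) :
    ‖f y - f x - f' x (y - x)‖ ≤ K * ‖y - x‖ ^ (m + 1) := by
  have hs := hU.segment_subset hx hy
  have := (convex_segment x y).norm_image_sub_le_of_norm_hasFDerivWithin_le' (𝕜 := ℝ) (f := f)
    (f' := f') (φ := f' x) (C := K * ‖y - x‖ ^ m)
    (fun z hz => (hf z (hs hz)).hasFDerivWithinAt)
    (fun z hz => (hb z (hs hz)).trans (mul_le_mul_of_nonneg_left
      (pow_le_pow_left₀ (norm_nonneg _) (norm_sub_le_of_mem_segment hz) m) hK))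
    (left_mem_segment ℝ x y) (right_mem_segment ℝ x y)
  rwa [mul_assoc, ← pow_succ] at this

theorem norm_fderiv_sub_le {f : E → ℝ} {U : Set E} (hU : Convex ℝ U) (hUo : IsOpen U)
    (hf : ContDiffOn ℝ 2 f U) {K : ℝ} (hb : ∀ z ∈ U, ‖iteratedFDeriv ℝ 2 f z‖ ≤ K) {x y : E}
    (hx : x ∈ U) (hy : y ∈ U) : ‖fderiv ℝ f y - fderiv ℝ f x‖ ≤ K * ‖y - x‖ := by
  refine hU.norm_image_sub_le_of_norm_fderiv_le (𝕜 := ℝ) (fun z hz => ?_) (fun z hz => ?_) hx hy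
  · exact (((hf.contDiffAt (hUo.mem_nhds hz)).fderiv_right (m := 1) (by norm_num)).differentiableAt
      (by simp))
  · rw [← norm_iteratedFDeriv_one, norm_iteratedFDeriv_fderiv]
    exact hb z hz

theorem abs_taylor_one_le {f : E → ℝ} {U : Set E} (hU : Convex ℝ U) (hUo : IsOpen U)
    (hf : ContDiffOn ℝ 2 f U) {K : ℝ} (hK : 0 ≤ K) (hb : ∀ z ∈ U, ‖iteratedFDeriv ℝ 2 f z‖ ≤ K)
    {x y : E} (hx : x ∈ U) (hy : y ∈ U) :
    |f y - f x - fderiv ℝ f x (y - x)| ≤ K * ‖y - x‖ ^ 2 :=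
  norm_taylor_one_le hU (fun z hz =>
    ((hf.contDiffAt (hUo.mem_nhds hz)).differentiableAt (by simp)).hasFDerivAt) hK 1 hx hy
    fun z hz => by rw [pow_one]; exact norm_fderiv_sub_le hU hUo hf hb hx hz

/-- By symmetry of the second derivative, ½D²f(x)(z-x)(z-x) has derivative D²f(x)(z-x) in z.
Subtracting it from f reduces the claim to `norm_taylor_one_le` with m = 2. -/
theorem abs_taylor_two_le {f : E → ℝ} {U : Set E} (hU : Convex ℝ U) (hUo : IsOpen U)
    (hf : ContDiffOn ℝ 3 f U) {K : ℝ} (hK : 0 ≤ K) (hb : ∀ z ∈ U, ‖iteratedFDeriv ℝ 3 f z‖ ≤ K)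
    {x y : E} (hx : x ∈ U) (hy : y ∈ U) :
    |f y - f x - fderiv ℝ f x (y - x) - 1 / 2 * fderiv ℝ (fderiv ℝ f) x (y - x) (y - x)|
      ≤ K * ‖y - x‖ ^ 3 := by
  have hf1 : ∀ z ∈ U, ContDiffAt ℝ 2 (fderiv ℝ f) z := fun z hz =>
    (hf.contDiffAt (hUo.mem_nhds hz)).fderiv_right (by norm_num)
  have hf2 : ∀ z ∈ U, ContDiffAt ℝ 1 (fderiv ℝ (fderiv ℝ f)) z := fun z hz =>
    (hf1 z hz).fderiv_right (by norm_num)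
  set A := fderiv ℝ (fderiv ℝ f) x with hA
  have hsym : ∀ v w, A v w = A w v :=
    (hf.contDiffAt (hUo.mem_nhds hx)).isSymmSndFDerivAt (by simp; norm_num)
  have h2 : ∀ z ∈ U, ‖fderiv ℝ (fderiv ℝ f) z - A‖ ≤ K * ‖z - x‖ := fun z hz => by
    refine hU.norm_image_sub_le_of_norm_fderiv_le (𝕜 := ℝ)
      (fun w hw => (hf2 w hw).differentiableAt (by simp)) (fun w hw => ?_) hx hz
    rw [← norm_iteratedFDeriv_one, norm_iteratedFDeriv_fderiv, norm_iteratedFDeriv_fderiv]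
    exact hb w hw
  have h1 : ∀ z ∈ U, ‖fderiv ℝ f z - fderiv ℝ f x - A (z - x)‖ ≤ K * ‖z - x‖ ^ 2 := fun z hz =>
    norm_taylor_one_le hU (fun w hw => ((hf1 w hw).differentiableAt (by simp)).hasFDerivAt) hK 1
      hx hz fun w hw => by rw [pow_one]; exact h2 w hw
  have hg : ∀ z ∈ U, HasFDerivAt (fun z => f z - 1 / 2 * A (z - x) (z - x))
      (fderiv ℝ f z - A (z - x)) z := fun z hz => by
    have d1 : HasFDerivAt (fun z => z - x) (ContinuousLinearMap.id ℝ E) z :=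
      (hasFDerivAt_id z).sub_const x
    have d2 : HasFDerivAt (fun z => A (z - x)) A z := A.hasFDerivAt.comp z d1
    have d3 := (d2.clm_apply d1).const_mul (1 / 2 : ℝ)
    refine ((((hf.contDiffAt (hUo.mem_nhds hz)).differentiableAt
      (by simp)).hasFDerivAt).sub d3).congr_fderiv ?_
    ext v
    simp [hsym v z, hsym v x]
    ring
  have h0 := norm_taylor_one_le hU hg hK 2 hx hy fun z hz => by
    simpa [sub_right_comm] using h1 z hz
  rw [Real.norm_eq_abs] at h0
  refine le_trans (le_of_eq ?_) h0
  congr 1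
  simp
  ring

end Taylor

/-! ### Moments of the radial kernel. -/

section Profile

theorem IsKernelProfile.nonneg {η : ℝ → ℝ} (hη : IsKernelProfile η) {t : ℝ} (ht : 0 ≤ t) :
    0 ≤ η t := by
  have := hη.antitone (mem_Ici.2 ht) (mem_Ici.2 (by linarith : (0 : ℝ) ≤ t + 3))
    (by linarith)
  rwa [hη.eq_zero _ (by linarith)] at this

theorem IsKernelProfile.le_zero {η : ℝ → ℝ} (hη : IsKernelProfile η) {t : ℝ} (ht : 0 ≤ t) :
    η t ≤ η 0 :=
  hη.antitone (mem_Ici.2 le_rfl) (mem_Ici.2 ht) ht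

theorem IsKernelProfile.abs_le {η : ℝ → ℝ} (hη : IsKernelProfile η) {t : ℝ} (ht : 0 ≤ t) :
    |η t| ≤ η 0 := by
  rw [abs_of_nonneg (hη.nonneg ht)]; exact hη.le_zero ht

theorem IsKernelProfile.zero_pos {η : ℝ → ℝ} (hη : IsKernelProfile η) : 0 < η 0 :=
  one_pos.trans_le (hη.one_le 0 le_rfl zero_le_one)

theorem IsKernelProfile.measurable_comp {η : ℝ → ℝ} (hη : IsKernelProfile η) {E : Type*}
    [MeasurableSpace E] {f : E → ℝ} (hf : Measurable f) (hf0 : ∀ x, 0 ≤ f x) :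
    Measurable fun x => η (f x) := by
  -- Values of η at negative arguments are arbitrary; freezing them at η(0) gives a monotone, hence
  -- measurable, function on the line.
  have h : Antitone fun t => η (max t 0) := fun a b hab =>
    hη.antitone (mem_Ici.2 (le_max_right _ _)) (mem_Ici.2 (le_max_right _ _))
      (max_le_max_right 0 hab)
  have := h.measurable.comp hf
  simpa [Function.comp_def, max_eq_left (hf0 _)] using this

variable {d : ℕ}

theorem IsKernelProfile.integrable_mul {η : ℝ → ℝ} (hη : IsKernelProfile η)
    {q : EuclideanSpace ℝ (Fin d) → ℝ} (hq : Measurable q) {B : ℝ}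
    (hB : ∀ z, ‖z‖ ≤ 2 → |q z| ≤ B) :
    Integrable fun z : EuclideanSpace ℝ (Fin d) => η ‖z‖ * q z := by
  have hm : Measurable fun z : EuclideanSpace ℝ (Fin d) => η ‖z‖ * q z :=
    (hη.measurable_comp measurable_norm fun _ => norm_nonneg _).mul hq
  have hs : (Metric.closedBall (0 : EuclideanSpace ℝ (Fin d)) 2).indicator
      (fun z => η ‖z‖ * q z) = fun z => η ‖z‖ * q z := by
    refine indicator_eq_self.2 fun z hz => ?_
    rw [mem_closedBall_zero_iff]
    by_contra h
    exact hz (by simp [hη.eq_zero _ (not_le.1 h)])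
  rw [← hs, integrable_indicator_iff Metric.isClosed_closedBall.measurableSet]
  refine Measure.integrableOn_of_bounded (M := η 0 * B)
    (measure_closedBall_lt_top).ne hm.aestronglyMeasurable ?_
  refine (ae_restrict_iff' Metric.isClosed_closedBall.measurableSet).2
    (Filter.Eventually.of_forall fun z hz => ?_)
  rw [Real.norm_eq_abs, abs_mul]
  exact mul_le_mul (hη.abs_le (norm_nonneg _)) (hB z (mem_closedBall_zero_iff.1 hz))
    (abs_nonneg _) hη.zero_pos.le

/-- Needs no integrability. The moments follow from three norm-preserving maps: z ↦ -z for first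
moments, reflection of one coordinate for mixed second moments, and the swap of coordinates k and 0
for the diagonal ones. -/
theorem integral_comp_isometry (e : EuclideanSpace ℝ (Fin d) ≃ₗᵢ[ℝ] EuclideanSpace ℝ (Fin d))
    (f : EuclideanSpace ℝ (Fin d) → ℝ) : ∫ z, f (e z) = ∫ z, f z :=
  e.measurePreserving.integral_comp e.toHomeomorph.measurableEmbedding f

theorem integral_radial_mul_coord (η : ℝ → ℝ) (k : Fin d) :
    ∫ z : EuclideanSpace ℝ (Fin d), η ‖z‖ * z k = 0 := by
  have := integral_comp_isometry (LinearIsometryEquiv.neg ℝ)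
    fun z : EuclideanSpace ℝ (Fin d) => η ‖z‖ * z k
  simp [integral_neg] at this
  linarith

theorem integral_radial_mul_coord_mul_coord_of_ne (η : ℝ → ℝ) {k l : Fin d} (hkl : k ≠ l) :
    ∫ z : EuclideanSpace ℝ (Fin d), η ‖z‖ * (z k * z l) = 0 := by
  obtain ⟨e, hk, hl⟩ : ∃ e : EuclideanSpace ℝ (Fin d) ≃ₗᵢ[ℝ] EuclideanSpace ℝ (Fin d),
      (∀ z, e z k = -z k) ∧ ∀ z, e z l = z l :=
    ⟨LinearIsometryEquiv.piLpCongrRight 2 fun i : Fin d =>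
      if i = k then LinearIsometryEquiv.neg ℝ else LinearIsometryEquiv.refl ℝ ℝ,
      by simp, by simp [hkl.symm]⟩
  have := integral_comp_isometry e fun z : EuclideanSpace ℝ (Fin d) => η ‖z‖ * (z k * z l)
  simp only [e.norm_map, hk, hl, neg_mul, mul_neg, integral_neg] at this
  linarith

theorem integral_radial_mul_coord_sq [NeZero d] (η : ℝ → ℝ) (k : Fin d) :
    ∫ z : EuclideanSpace ℝ (Fin d), η ‖z‖ * (z k * z k) = kernelMoment d η := by
  have := integral_comp_isometry (LinearIsometryEquiv.piLpCongrLeft 2 ℝ ℝ (Equiv.swap k 0))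
    fun z : EuclideanSpace ℝ (Fin d) => η ‖z‖ * (z k * z k)
  rw [← this, kernelMoment]
  refine integral_congr_ae (Filter.Eventually.of_forall fun z => ?_)
  simp [LinearIsometryEquiv.piLpCongrLeft_apply, sq]

theorem integral_radial_mul_coord_mul_coord [NeZero d] (η : ℝ → ℝ) (k l : Fin d) :
    ∫ z : EuclideanSpace ℝ (Fin d), η ‖z‖ * (z k * z l)
      = if k = l then kernelMoment d η else 0 := by
  split_ifs with h
  · rw [h, integral_radial_mul_coord_sq]
  · exact integral_radial_mul_coord_mul_coord_of_ne η h

end Profile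

/-! ### Expanded form of the weighted Laplacian. -/

section Laplacian

variable {d : ℕ}

theorem gradient_apply_coord (φ : EuclideanSpace ℝ (Fin d) → ℝ) (x : EuclideanSpace ℝ (Fin d))
    (i : Fin d) : gradient φ x i = fderiv ℝ φ x (EuclideanSpace.single i 1) := by
  have := InnerProductSpace.toDual_symm_apply (𝕜 := ℝ) (x := EuclideanSpace.single i (1 : ℝ))
    (y := fderiv ℝ φ x)
  rw [← this, gradient, EuclideanSpace.inner_single_right]
  simp

theorem fderiv_gradient_apply {φ : EuclideanSpace ℝ (Fin d) → ℝ} {x : EuclideanSpace ℝ (Fin d)}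
    (hφ : DifferentiableAt ℝ (fderiv ℝ φ) x) :
    DifferentiableAt ℝ (gradient φ) x ∧ ∀ v i,
      fderiv ℝ (gradient φ) x v i = fderiv ℝ (fderiv ℝ φ) x v (EuclideanSpace.single i 1) := by
  have hc : ∀ i, HasFDerivAt (fun y => gradient φ y i)
      ((fderiv ℝ (fderiv ℝ φ) x).flip (EuclideanSpace.single i 1)) x := fun i => by
    simp_rw [gradient_apply_coord]
    have := hφ.hasFDerivAt.clm_apply (hasFDerivAt_const (EuclideanSpace.single i (1 : ℝ)) x)
    refine this.congr_fderiv ?_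
    ext v
    simp
  have hd : DifferentiableAt ℝ (gradient φ) x :=
    differentiableAt_euclidean.2 fun i => (hc i).differentiableAt
  refine ⟨hd, fun v i => ?_⟩
  have h1 : HasFDerivAt (fun y => gradient φ y i)
      ((EuclideanSpace.proj i : EuclideanSpace ℝ (Fin d) →L[ℝ] ℝ).comp
        (fderiv ℝ (gradient φ) x)) x :=
    (EuclideanSpace.proj i : EuclideanSpace ℝ (Fin d) →L[ℝ] ℝ).hasFDerivAt.comp x hd.hasFDerivAt
  have := congrArg (fun L => L v) (h1.unique (hc i))
  simpa using this

/-- Product rule, with ρ⁻¹ cancelling one factor ρ. In this form the operator matches the moments: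
first derivatives of φ meet the linear part of (γ(x)+γ(y))ρ(y) at x, second derivatives meet half of
its value 2γ(x)ρ(x). -/
theorem weightedLaplacian_eq {γ ρ φ : EuclideanSpace ℝ (Fin d) → ℝ} {x : EuclideanSpace ℝ (Fin d)}
    (hγ : DifferentiableAt ℝ γ x) (hρ : DifferentiableAt ℝ ρ x) (hρx : ρ x ≠ 0)
    (hφ : DifferentiableAt ℝ (fderiv ℝ φ) x) :
    weightedLaplacian γ ρ φ x =
      ∑ k, fderiv ℝ φ x (EuclideanSpace.single k 1) *
        (ρ x * fderiv ℝ γ x (EuclideanSpace.single k 1)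
          + 2 * γ x * fderiv ℝ ρ x (EuclideanSpace.single k 1))
      + γ x * ρ x * ∑ k, fderiv ℝ (fderiv ℝ φ) x (EuclideanSpace.single k 1)
          (EuclideanSpace.single k 1) := by
  obtain ⟨hd, hg⟩ := fderiv_gradient_apply hφ
  have h1 := (hγ.hasFDerivAt.mul (hρ.hasFDerivAt.pow 2)).smul hd.hasFDerivAt
  have h2 : fderiv ℝ (fun y => (γ y * ρ y ^ 2) • gradient φ y) x = _ := h1.fderiv
  rw [weightedLaplacian, divergence, h2, Finset.mul_sum, Finset.mul_sum, ← Finset.sum_add_distrib]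
  refine Finset.sum_congr rfl fun k _ => ?_
  simp [hg, gradient_apply_coord]
  field_simp
  ring

end Laplacian

/-! ### Bounds for the data measure. -/

section Density

variable {d : ℕ} {Ω : Set (EuclideanSpace ℝ (Fin d))} {ρ : EuclideanSpace ℝ (Fin d) → ℝ}

theorem IsDataDensity.exists_bound (hΩb : Bornology.IsBounded Ω) (hΩ : IsOpen Ω)
    (hρ : IsDataDensity Ω ρ) :
    ∃ L : ℝ, 0 < L ∧ (∀ x ∈ Ω, 0 < ρ x ∧ ρ x ≤ L ∧ ‖fderiv ℝ ρ x‖ ≤ L) ∧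
      ∀ U ⊆ Ω, Convex ℝ U → ∀ x ∈ U, ∀ y ∈ U,
        |ρ y - ρ x - fderiv ℝ ρ x (y - x)| ≤ L * ‖y - x‖ ^ 2 := by
  obtain ⟨a, b, ha, hab⟩ := hρ.bounds
  obtain ⟨K, hK⟩ := hρ.lipschitz
  obtain ⟨D, hD⟩ : ∃ D : ℝ, ∀ x ∈ Ω, ‖fderiv ℝ ρ x‖ ≤ D := by
    rcases Ω.eq_empty_or_nonempty with rfl | ⟨p, hp⟩
    · exact ⟨0, by simp⟩
    obtain ⟨D, hD⟩ := Metric.isBounded_iff.1 hΩb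
    refine ⟨K * D + ‖fderiv ℝ ρ p‖, fun x hx => ?_⟩
    have h1 := hK.norm_sub_le hx hp
    have h2 : ‖x - p‖ ≤ D := by rw [← dist_eq_norm]; exact hD hx hp
    have h3 := norm_le_norm_sub_add (fderiv ℝ ρ x) (fderiv ℝ ρ p)
    have h4 : (K : ℝ) * ‖x - p‖ ≤ K * D := mul_le_mul_of_nonneg_left h2 K.2
    linarith
  refine ⟨|b| + |D| + K + 1, by positivity, fun x hx => ⟨ha.trans_le (hab x hx).1, ?_, ?_⟩,
    fun U hU hc x hx y hy => ?_⟩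
  · linarith [(hab x hx).2, le_abs_self b, abs_nonneg D, K.2]
  · linarith [hD x hx, le_abs_self D, abs_nonneg b, K.2]
  · refine (norm_taylor_one_le hc (f := ρ) (f' := fderiv ℝ ρ) (fun z hz =>
      ((hρ.differentiable z (hU hz)).differentiableAt (hΩ.mem_nhds (hU hz))).hasFDerivAt)
      K.2 1 hx hy fun z hz => ?_).trans ?_
    · rw [pow_one]; exact hK.norm_sub_le (hU hz) (hU hx)
    · refine mul_le_mul_of_nonneg_right ?_ (by positivity)
      change (K : ℝ) ≤ _
      linarith [abs_nonneg b, abs_nonneg D]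

theorem integral_dataMeasure (hΩ : IsOpen Ω) (hρ : IsDataDensity Ω ρ)
    (f : EuclideanSpace ℝ (Fin d) → ℝ) :
    ∫ y, f y ∂(dataMeasure Ω ρ) = ∫ y in Ω, ρ y * f y := by
  obtain ⟨a, b, ha, hab⟩ := hρ.bounds
  have hm : AEMeasurable ρ (volume.restrict Ω) :=
    hρ.differentiable.continuousOn.aemeasurable hΩ.measurableSet
  rw [dataMeasure, integral_withDensity_eq_integral_toReal_smul₀ hm.ennreal_ofReal
    (Filter.Eventually.of_forall fun x => ENNReal.ofReal_lt_top)]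
  refine setIntegral_congr_fun hΩ.measurableSet fun y hy => ?_
  rw [smul_eq_mul, ENNReal.toReal_ofReal (ha.le.trans (hab y hy).1)]

theorem dataMeasure_apply_le (hΩ : IsOpen Ω) {L : ℝ} (hL : ∀ x ∈ Ω, ρ x ≤ L)
    {s : Set (EuclideanSpace ℝ (Fin d))} (hs : MeasurableSet s) :
    dataMeasure Ω ρ s ≤ ENNReal.ofReal L * volume s := by
  rw [dataMeasure, withDensity_apply _ hs, Measure.restrict_restrict hs]
  calc ∫⁻ x in s ∩ Ω, ENNReal.ofReal (ρ x) ≤ ∫⁻ _x in s ∩ Ω, ENNReal.ofReal L :=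
        setLIntegral_mono' (hs.inter hΩ.measurableSet) fun x hx =>
          ENNReal.ofReal_le_ofReal (hL x hx.2)
    _ = ENNReal.ofReal L * volume (s ∩ Ω) := by rw [setLIntegral_const]
    _ ≤ _ := by gcongr; exact inter_subset_left

theorem dataMeasure_compl (hΩ : IsOpen Ω) : dataMeasure Ω ρ Ωᶜ = 0 := by
  rw [dataMeasure, withDensity_apply _ hΩ.measurableSet.compl,
    Measure.restrict_restrict hΩ.measurableSet.compl]
  simp

theorem dataMeasure_null (hΩ : IsOpen Ω) (hρ : IsDataDensity Ω ρ)
    {s : Set (EuclideanSpace ℝ (Fin d))} (hs : MeasurableSet s) (h0 : volume s = 0) :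
    dataMeasure Ω ρ s = 0 := by
  obtain ⟨a, b, ha, hab⟩ := hρ.bounds
  have := dataMeasure_apply_le hΩ (fun x hx => (hab x hx).2) hs
  rwa [h0, mul_zero, nonpos_iff_eq_zero] at this

/-- The support lies in a ball of mass O(ε^d). Applied to the statistic it bounds the total mass,
applied to its square the variance. -/
theorem abs_integral_dataMeasure_le (hΩ : IsOpen Ω) (hρ : IsDataDensity Ω ρ) {L : ℝ}
    (hL0 : 0 ≤ L) (hL : ∀ x ∈ Ω, ρ x ≤ L)
    {f : EuclideanSpace ℝ (Fin d) → ℝ} {B ε : ℝ} (hε : 0 < ε) {x : EuclideanSpace ℝ (Fin d)}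
    (hf : ∀ y, |f y| ≤ B) (h0 : ∀ y, 2 * ε < ‖y - x‖ → f y = 0) :
    |∫ y, f y ∂(dataMeasure Ω ρ)|
      ≤ B * (L * volume.real (Metric.closedBall (0 : EuclideanSpace ℝ (Fin d)) 2) * ε ^ d) := by
  have := hρ.isProbability
  set s := Metric.closedBall x (ε * 2) with hs
  have hB : 0 ≤ B := (abs_nonneg _).trans (hf x)
  have hfs : s.indicator f = f := indicator_eq_self.2 fun y hy => by
    rw [hs, mem_closedBall_iff_norm]
    by_contra h
    exact hy (h0 y (by linarith))
  rw [← hfs, integral_indicator Metric.isClosed_closedBall.measurableSet, ← Real.norm_eq_abs]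
  refine (norm_setIntegral_le_of_norm_le_const (measure_lt_top _ _) fun y _ => hf y).trans ?_
  refine mul_le_mul_of_nonneg_left ?_ hB
  have h1 := dataMeasure_apply_le hΩ hL (s := s) Metric.isClosed_closedBall.measurableSet
  rw [hs, Measure.addHaar_closedBall_mul volume x hε.le (by norm_num : (0 : ℝ) ≤ 2),
    finrank_euclideanSpace_fin] at h1
  have h2 := ENNReal.toReal_mono (by
    refine ENNReal.mul_ne_top ENNReal.ofReal_ne_top (ENNReal.mul_ne_top ENNReal.ofReal_ne_top
      measure_closedBall_lt_top.ne)) h1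
  rw [ENNReal.toReal_mul, ENNReal.toReal_mul, ENNReal.toReal_ofReal hL0,
    ENNReal.toReal_ofReal (by positivity)] at h2
  refine h2.trans (le_of_eq ?_)
  simp only [Measure.real]
  ring

end Density

/-! ### Expansion of weight times density. -/

section Expansion

variable {d : ℕ} {Ω : Set (EuclideanSpace ℝ (Fin d))} {Γ : Finset (EuclideanSpace ℝ (Fin d))}
  {r₀ α : ℝ} {γ ρ : EuclideanSpace ℝ (Fin d) → ℝ}

theorem sub_lt_infDist_of_mem_ball {x y : EuclideanSpace ℝ (Fin d)} {r : ℝ}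
    {s : Set (EuclideanSpace ℝ (Fin d))} (hy : y ∈ Metric.ball x r) :
    Metric.infDist x s - r < Metric.infDist y s := by
  have h1 : Metric.infDist x s ≤ Metric.infDist y s + dist x y :=
    Metric.infDist_le_infDist_add_dist
  rw [Metric.mem_ball'] at hy
  linarith

theorem notMem_of_infDist_pos {x : EuclideanSpace ℝ (Fin d)}
    {s : Set (EuclideanSpace ℝ (Fin d))} (h : 0 < Metric.infDist x s) : x ∉ s := fun hx => by
  rw [Metric.infDist_zero_of_mem hx] at h
  exact h.false

/-- Expansion of `y ↦ (γ(x) + γ(y)) ρ(y)` at `x` to zeroth and first order. -/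
theorem abs_weight_sub_le (hΩ : IsOpen Ω) (hγ : IsPenaltyWeight Ω Γ r₀ α γ) (hα : 0 ≤ α)
    {K L D : ℝ} (hD : 1 ≤ D) (hDΩ : ∀ y ∈ Ω, Metric.infDist y Γ ≤ D) (hK0 : 0 < K)
    (hK : ∀ y ∈ Ω \ Γ, ∀ j ≤ 2, ‖iteratedFDeriv ℝ j γ y‖ ≤ K * Metric.infDist y Γ ^ (-(α + j)))
    (hL0 : 0 < L) (hL : ∀ x ∈ Ω, 0 < ρ x ∧ ρ x ≤ L ∧ ‖fderiv ℝ ρ x‖ ≤ L)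
    (hρ : IsDataDensity Ω ρ)
    (hL2 : ∀ U ⊆ Ω, Convex ℝ U → ∀ x ∈ U, ∀ y ∈ U,
        |ρ y - ρ x - fderiv ℝ ρ x (y - x)| ≤ L * ‖y - x‖ ^ 2)
    {ε : ℝ} (hε : 0 < ε) {x : EuclideanSpace ℝ (Fin d)} (hx : 2 * ε < Metric.infDist x Γ)
    (hball : Metric.ball x (2 * ε) ⊆ Ω) {y : EuclideanSpace ℝ (Fin d)}
    (hy : y ∈ Metric.ball x (2 * ε)) :
    |(γ x + γ y) * ρ y - 2 * γ x * ρ x|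
        ≤ K * L * (4 + 4 * D + 8 * D ^ 2) * (Metric.infDist x Γ - 2 * ε) ^ (-(α + 1)) * ε ∧
      |(γ x + γ y) * ρ y
          - (2 * γ x * ρ x + (ρ x * fderiv ℝ γ x (y - x) + 2 * γ x * fderiv ℝ ρ x (y - x)))|
        ≤ K * L * (4 + 4 * D + 8 * D ^ 2) * (Metric.infDist x Γ - 2 * ε) ^ (-(α + 2))
          * ε ^ 2 := by
  set m := Metric.infDist x Γ - 2 * ε with hm
  set U := Metric.ball x (2 * ε) with hU
  have hm0 : 0 < m := by linarith
  have hxU : x ∈ U := Metric.mem_ball_self (by linarith)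
  have hmD : m ≤ D := by linarith [hDΩ x (hball hxU)]
  have hUc : Convex ℝ U := convex_ball _ _
  have hUo : IsOpen U := Metric.isOpen_ball
  have hUm : ∀ z ∈ U, m < Metric.infDist z Γ := fun z hz => sub_lt_infDist_of_mem_ball hz
  have hUΩ : ∀ z ∈ U, z ∈ Ω \ Γ := fun z hz =>
    ⟨hball hz, notMem_of_infDist_pos (hm0.trans (hUm z hz))⟩
  have hKm : ∀ z ∈ U, ∀ j ≤ 2, ‖iteratedFDeriv ℝ j γ z‖ ≤ K * m ^ (-(α + j)) := fun z hz j hj =>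
    (hK z (hUΩ z hz) j hj).trans (mul_le_mul_of_nonneg_left
      (Real.rpow_le_rpow_of_nonpos hm0 (hUm z hz).le (by
        have : (0 : ℝ) ≤ j := Nat.cast_nonneg j
        linarith)) hK0.le)
  have hγc : ContDiffOn ℝ 2 γ U := fun z hz =>
    ((hγ.contDiffAt hΩ (hUΩ z hz)).of_le (by norm_cast)).contDiffWithinAt
  set v := y - x with hv
  set P := m ^ (-α) with hP
  have hP0 : 0 < P := Real.rpow_pos_of_pos hm0 _
  have e1 : m ^ (-(α + 1)) = P / m := by
    rw [neg_add, ← sub_eq_add_neg, Real.rpow_sub_one hm0.ne']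
  have e2 : m ^ (-(α + 2)) = P / m ^ 2 := by
    rw [neg_add, ← sub_eq_add_neg, Real.rpow_sub hm0, Real.rpow_two]
  have hvε : ‖v‖ ≤ 2 * ε := by
    rw [hv, ← dist_eq_norm]; exact (Metric.mem_ball.1 hy).le
  have g0 : ∀ z ∈ U, |γ z| ≤ K * P := fun z hz => by
    have := hKm z hz 0 (by norm_num)
    simpa using this
  have g1 : ∀ z ∈ U, ‖fderiv ℝ γ z‖ ≤ K * (P / m) := fun z hz => by
    have := hKm z hz 1 (by norm_num)
    rwa [norm_iteratedFDeriv_one, Nat.cast_one, e1] at this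
  have g2 : ∀ z ∈ U, ‖iteratedFDeriv ℝ 2 γ z‖ ≤ K * (P / m ^ 2) := fun z hz => by
    have := hKm z hz 2 (by norm_num)
    rwa [Nat.cast_ofNat, e2] at this
  have t1 : |γ y - γ x| ≤ K * (P / m) * ‖v‖ :=
    hUc.norm_image_sub_le_of_norm_fderiv_le (𝕜 := ℝ) (fun z hz =>
      (hγc.contDiffAt (hUo.mem_nhds hz)).differentiableAt (by simp)) g1 hxU hy
  have t2 : |γ y - γ x - fderiv ℝ γ x v| ≤ K * (P / m ^ 2) * ‖v‖ ^ 2 :=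
    abs_taylor_one_le hUc hUo hγc (by positivity) g2 hxU hy
  have r1 : |ρ y - ρ x| ≤ L * ‖v‖ :=
    hUc.norm_image_sub_le_of_norm_fderiv_le (𝕜 := ℝ) (fun z hz =>
      (hρ.differentiable z (hball hz)).differentiableAt (hΩ.mem_nhds (hball hz)))
      (fun z hz => (hL z (hball hz)).2.2) hxU hy
  have r2 : |ρ y - ρ x - fderiv ℝ ρ x v| ≤ L * ‖v‖ ^ 2 := hL2 U hball hUc x hxU y hy
  have ry : |ρ y| ≤ L := by
    rw [abs_of_pos (hL y (hball hy)).1]; exact (hL y (hball hy)).2.1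
  have dv : |fderiv ℝ γ x v| ≤ K * (P / m) * ‖v‖ :=
    (ContinuousLinearMap.le_opNorm _ _).trans
      (mul_le_mul_of_nonneg_right (g1 x hxU) (norm_nonneg _))
  have gx := g0 x hxU
  have hv2 : ‖v‖ ^ 2 ≤ 4 * ε ^ 2 := by
    calc ‖v‖ ^ 2 ≤ (2 * ε) ^ 2 := pow_le_pow_left₀ (norm_nonneg _) hvε 2
      _ = _ := by ring
  -- Since m ≤ D, a missing inverse power of m costs a factor D. This brings the terms with fewer
  -- derivatives on γ to the most singular power.
  have hPm : P ≤ D * (P / m) := by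
    rw [mul_div_assoc', le_div_iff₀ hm0, mul_comm D]
    exact mul_le_mul_of_nonneg_left hmD hP0.le
  have hPm2 : P / m ≤ D * (P / m ^ 2) := by
    rw [mul_div_assoc', div_le_div_iff₀ hm0 (by positivity)]
    nlinarith [mul_le_mul_of_nonneg_left hmD (mul_pos hP0 hm0).le]
  set p1 := P / m with hp1
  set p2 := P / m ^ 2 with hp2
  have hp10 : 0 < p1 := by positivity
  have hp20 : 0 < p2 := by positivity
  rw [e1, e2]
  constructor
  · calc |(γ x + γ y) * ρ y - 2 * γ x * ρ x|
        = |(γ y - γ x) * ρ y + 2 * (γ x * (ρ y - ρ x))| := by congr 1; ring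
      _ ≤ |γ y - γ x| * |ρ y| + 2 * (|γ x| * |ρ y - ρ x|) := by
          refine (abs_add_le _ _).trans (le_of_eq ?_)
          rw [abs_mul, abs_mul, abs_mul, abs_two]
      _ ≤ (K * p1 * (2 * ε)) * L + 2 * ((K * (D * p1)) * (L * (2 * ε))) := by
          gcongr
          · exact t1.trans (by gcongr)
          · exact gx.trans (by gcongr)
          · exact r1.trans (by gcongr)
      _ = K * L * (2 + 4 * D) * p1 * ε := by ring
      _ ≤ _ := by
          have hc : 2 + 4 * D ≤ 4 + 4 * D + 8 * D ^ 2 := by nlinarith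
          have := mul_le_mul_of_nonneg_left hc (by positivity : 0 ≤ K * L * p1 * ε)
          linarith
  · calc |(γ x + γ y) * ρ y
          - (2 * γ x * ρ x + (ρ x * fderiv ℝ γ x v + 2 * γ x * fderiv ℝ ρ x v))|
        = |(γ y - γ x - fderiv ℝ γ x v) * ρ y + fderiv ℝ γ x v * (ρ y - ρ x)
            + 2 * (γ x * (ρ y - ρ x - fderiv ℝ ρ x v))| := by congr 1; ring
      _ ≤ |γ y - γ x - fderiv ℝ γ x v| * |ρ y| + |fderiv ℝ γ x v| * |ρ y - ρ x|
            + 2 * (|γ x| * |ρ y - ρ x - fderiv ℝ ρ x v|) := by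
          refine (abs_add_three _ _ _).trans (le_of_eq ?_)
          rw [abs_mul, abs_mul, abs_mul, abs_mul, abs_two]
      _ ≤ (K * p2 * (4 * ε ^ 2)) * L + (K * (D * p2) * (2 * ε)) * (L * (2 * ε))
            + 2 * ((K * (D * (D * p2))) * (L * (4 * ε ^ 2))) := by
          gcongr
          · exact t2.trans (by gcongr)
          · exact dv.trans (by gcongr)
          · exact r1.trans (by gcongr)
          · exact gx.trans (by gcongr; exact hPm.trans (by gcongr))
          · exact r2.trans (by gcongr)
      _ = _ := by ring

end Expansion

/-! ### The normalised local statistic and its expectation. -/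

section LocalStatistic

variable {d : ℕ} {Ω : Set (EuclideanSpace ℝ (Fin d))} {Γ : Finset (EuclideanSpace ℝ (Fin d))}
  {r₀ α : ℝ} {η : ℝ → ℝ} {γ ρ : EuclideanSpace ℝ (Fin d) → ℝ}

open Classical in
/-- The summand `(dist(x, Γ) - 2ε)^α (γ(x) + γ(y)) η(|y - x| / ε) q((y - x) / ε)` of the graph
Laplacian tested against the profile `q`, with `γ` set to zero off `Ω \ Γ`, and set to zero for `x`
within `2ε` of `Γ`. -/
noncomputable def localStatistic (Ω : Set (EuclideanSpace ℝ (Fin d)))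
    (Γ : Finset (EuclideanSpace ℝ (Fin d))) (η : ℝ → ℝ) (γ : EuclideanSpace ℝ (Fin d) → ℝ)
    (α ε : ℝ) (q : EuclideanSpace ℝ (Fin d) → ℝ) (x y : EuclideanSpace ℝ (Fin d)) : ℝ :=
  if 2 * ε < Metric.infDist x Γ then
    (Metric.infDist x Γ - 2 * ε) ^ α * ((Ω \ Γ).indicator γ x + (Ω \ Γ).indicator γ y)
      * (η (‖y - x‖ / ε) * q (ε⁻¹ • (y - x)))
  else 0

theorem measurable_localStatistic (hΩ : IsOpen Ω) (hη : IsKernelProfile η)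
    (hγ : IsPenaltyWeight Ω Γ r₀ α γ) {ε : ℝ} (hε : 0 < ε)
    {q : EuclideanSpace ℝ (Fin d) → ℝ} (hq : Measurable q) :
    Measurable fun p : EuclideanSpace ℝ (Fin d) × EuclideanSpace ℝ (Fin d) =>
      localStatistic Ω Γ η γ α ε q p.1 p.2 := by
  classical
  have hg : Measurable ((Ω \ Γ).indicator γ) := by
    rw [← piecewise_eq_indicator]
    exact ((hγ.smooth.continuousOn).mono
      (sdiff_subset_sdiff_left subset_closure)).measurable_piecewise continuousOn_const
      (isOpen_diff_finset hΩ Γ).measurableSet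
  have hd : Measurable fun p : EuclideanSpace ℝ (Fin d) × EuclideanSpace ℝ (Fin d) =>
      Metric.infDist p.1 Γ := (Metric.continuous_infDist_pt _).measurable.comp measurable_fst
  have hs : Measurable fun p : EuclideanSpace ℝ (Fin d) × EuclideanSpace ℝ (Fin d) =>
      p.2 - p.1 := measurable_snd.sub measurable_fst
  unfold localStatistic
  refine Measurable.ite (measurableSet_lt measurable_const hd) ?_ measurable_const
  refine (((hd.sub_const _).pow_const _).mul
    ((hg.comp measurable_fst).add (hg.comp measurable_snd))).mul (Measurable.mul ?_ ?_)
  · exact hη.measurable_comp (hs.norm.div_const ε) fun p => by positivity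
  · exact hq.comp (hs.const_smul ε⁻¹)

theorem localStatistic_eq_zero (hη : IsKernelProfile η) {ε : ℝ} (hε : 0 < ε)
    (q : EuclideanSpace ℝ (Fin d) → ℝ) {x y : EuclideanSpace ℝ (Fin d)} (h : 2 * ε < ‖y - x‖) :
    localStatistic Ω Γ η γ α ε q x y = 0 := by
  have : η (‖y - x‖ / ε) = 0 := hη.eq_zero _ ((lt_div_iff₀ hε).2 h)
  simp [localStatistic, this]

theorem norm_inv_smul_le {E : Type*} [NormedAddCommGroup E] [NormedSpace ℝ E] {ε : ℝ}
    (hε : 0 < ε) {v : E} (hv : ‖v‖ ≤ 2 * ε) : ‖ε⁻¹ • v‖ ≤ 2 := by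
  rw [norm_smul, norm_inv, Real.norm_of_nonneg hε.le, inv_mul_le_iff₀ hε]
  linarith

/-- On B(x,2ε) the weight is at most K M^{-α}, which the prefactor M^α cancels. The bound is thus
free of x and ε, as a uniform Bernstein inequality requires. -/
theorem abs_localStatistic_le (hη : IsKernelProfile η) (hα : 0 ≤ α) {K : ℝ} (hK0 : 0 < K)
    (hK : ∀ y ∈ Ω \ Γ, ∀ j ≤ 2, ‖iteratedFDeriv ℝ j γ y‖ ≤ K * Metric.infDist y Γ ^ (-(α + j)))
    {ε : ℝ} (hε : 0 < ε) {q : EuclideanSpace ℝ (Fin d) → ℝ} (hq : ∀ z, ‖z‖ ≤ 2 → |q z| ≤ 4)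
    (x y : EuclideanSpace ℝ (Fin d)) :
    |localStatistic Ω Γ η γ α ε q x y| ≤ 8 * K * η 0 := by
  have hη0 := hη.zero_pos
  by_cases hv : 2 * ε < ‖y - x‖
  · rw [localStatistic_eq_zero hη hε q hv, abs_zero]; positivity
  unfold localStatistic
  split_ifs with hx
  swap
  · rw [abs_zero]; positivity
  set m := Metric.infDist x Γ - 2 * ε with hm
  have hm0 : 0 < m := by linarith
  have hg : ∀ z, m ≤ Metric.infDist z Γ → |(Ω \ Γ).indicator γ z| ≤ K * m ^ (-α) := fun z hz => by
    by_cases hzm : z ∈ Ω \ (Γ : Set (EuclideanSpace ℝ (Fin d)))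
    · rw [indicator_of_mem hzm]
      have := hK z hzm 0 (by norm_num)
      simp only [norm_iteratedFDeriv_zero, Nat.cast_zero, add_zero, Real.norm_eq_abs] at this
      exact this.trans (mul_le_mul_of_nonneg_left
        (Real.rpow_le_rpow_of_nonpos hm0 hz (by linarith)) hK0.le)
    · rw [indicator_of_notMem hzm, abs_zero]; positivity
  have h1 := hg x (by linarith)
  have h2 := hg y (by
    have h1 : Metric.infDist x Γ ≤ Metric.infDist y Γ + dist x y :=
      Metric.infDist_le_infDist_add_dist
    rw [dist_comm, dist_eq_norm] at h1
    linarith)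
  have hP : m ^ α * m ^ (-α) = 1 := by
    rw [← Real.rpow_add hm0, add_neg_cancel, Real.rpow_zero]
  rw [abs_mul, abs_mul, abs_mul, abs_of_pos (Real.rpow_pos_of_pos hm0 α)]
  calc m ^ α * |(Ω \ Γ).indicator γ x + (Ω \ Γ).indicator γ y|
        * (|η (‖y - x‖ / ε)| * |q (ε⁻¹ • (y - x))|)
      ≤ m ^ α * (K * m ^ (-α) + K * m ^ (-α)) * (η 0 * 4) := by
        gcongr
        · exact (abs_add_le _ _).trans (add_le_add h1 h2)
        · exact hη.abs_le (by positivity)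
        · exact hq _ (norm_inv_smul_le hε (not_lt.1 hv))
    _ = 8 * K * η 0 * (m ^ α * m ^ (-α)) := by ring
    _ = _ := by rw [hP, mul_one]

theorem integral_comp_inv_smul_sub {ε : ℝ} (hε : 0 < ε) (x : EuclideanSpace ℝ (Fin d))
    (F : EuclideanSpace ℝ (Fin d) → ℝ) :
    ∫ y, F (ε⁻¹ • (y - x)) = ε ^ d * ∫ z, F z := by
  rw [integral_sub_right_eq_self (fun y => F (ε⁻¹ • y)) x,
    Measure.integral_comp_inv_smul_of_nonneg volume F hε.le, finrank_euclideanSpace_fin,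
    smul_eq_mul]

/-- The expectation of the local statistic, when the weight is replaced by a model `Q`. -/
theorem abs_integral_localStatistic_sub_le [NeZero d] (hΩ : IsOpen Ω) (hη : IsKernelProfile η)
    (hγ : IsPenaltyWeight Ω Γ r₀ α γ) (hρ : IsDataDensity Ω ρ) {ε : ℝ} (hε : 0 < ε)
    {q : EuclideanSpace ℝ (Fin d) → ℝ} (hqm : Measurable q) (hq : ∀ z, ‖z‖ ≤ 2 → |q z| ≤ 4)
    {x : EuclideanSpace ℝ (Fin d)} (hx : 2 * ε < Metric.infDist x Γ)
    (hball : Metric.ball x (2 * ε) ⊆ Ω) {Q : EuclideanSpace ℝ (Fin d) → ℝ} (hQ : Continuous Q)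
    {T : ℝ} (hT : ∀ y ∈ Metric.ball x (2 * ε), |(γ x + γ y) * ρ y - Q (y - x)| ≤ T) :
    |∫ y, localStatistic Ω Γ η γ α ε q x y ∂(dataMeasure Ω ρ)
        - (Metric.infDist x Γ - 2 * ε) ^ α * (ε ^ d * ∫ z, η ‖z‖ * (Q (ε • z) * q z))|
      ≤ (Metric.infDist x Γ - 2 * ε) ^ α * (T * (4 * η 0) *
          (volume.real (Metric.closedBall (0 : EuclideanSpace ℝ (Fin d)) 2) * ε ^ d)) := by
  set m := Metric.infDist x Γ - 2 * ε with hm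
  have hm0 : 0 < m := by linarith
  set U := Metric.ball x (2 * ε) with hU
  have hUm : MeasurableSet U := Metric.isOpen_ball.measurableSet
  have hxU : x ∈ U := Metric.mem_ball_self (by linarith)
  have hUΩ : ∀ z ∈ U, z ∈ Ω \ (Γ : Set (EuclideanSpace ℝ (Fin d))) := fun z hz =>
    ⟨hball hz, notMem_of_infDist_pos (hm0.trans (sub_lt_infDist_of_mem_ball hz))⟩
  set κ : EuclideanSpace ℝ (Fin d) → ℝ := fun y => η (‖y - x‖ / ε) * q (ε⁻¹ • (y - x)) with hκ
  have hκm : Measurable κ := by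
    have hs : Measurable fun y : EuclideanSpace ℝ (Fin d) => y - x := measurable_id.sub_const x
    exact (hη.measurable_comp (hs.norm.div_const ε) fun p => by positivity).mul
      (hqm.comp (hs.const_smul ε⁻¹))
  have hκ0 : ∀ y, 2 * ε < ‖y - x‖ → κ y = 0 := fun y hy => by
    simp only [hκ, hη.eq_zero _ ((lt_div_iff₀ hε).2 hy), zero_mul]
  have hκU : ∀ y ∈ U, |κ y| ≤ 4 * η 0 := fun y hy => by
    have hy' : ‖y - x‖ < 2 * ε := mem_ball_iff_norm.1 hy
    rw [hκ, abs_mul, mul_comm 4]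
    exact mul_le_mul (hη.abs_le (by positivity)) (hq _ (norm_inv_smul_le hε hy'.le))
      (abs_nonneg _) hη.zero_pos.le
  -- η(2) may be nonzero, so κ need not vanish on the sphere of radius 2ε. The sphere is null, and
  -- the integrals reduce to the open ball, where the expansion is available.
  have hsph : ∀ᵐ y, y ∉ Metric.sphere x (2 * ε) :=
    measure_eq_zero_iff_ae_notMem.1 (Measure.addHaar_sphere_of_ne_zero volume x (by positivity))
  have hout : ∀ y, y ∉ Metric.sphere x (2 * ε) → y ∉ U → κ y = 0 := fun y h1 h2 => by
    refine hκ0 y (lt_of_le_of_ne ?_ ?_)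
    · rw [hU, mem_ball_iff_norm, not_lt] at h2; exact h2
    · rw [mem_sphere_iff_norm] at h1; exact fun h => h1 h.symm
  have e1 : ∫ y, localStatistic Ω Γ η γ α ε q x y ∂(dataMeasure Ω ρ)
      = ∫ y in U, m ^ α * (((γ x + γ y) * ρ y) * κ y) := by
    rw [integral_dataMeasure hΩ hρ]
    refine (setIntegral_eq_of_subset_of_ae_sdiff_eq_zero hΩ.measurableSet.nullMeasurableSet hball
      ?_).trans ?_
    rotate_left
    · refine setIntegral_congr_fun hUm fun y hy => ?_
      simp only [localStatistic, if_pos hx, indicator_of_mem (hUΩ x hxU),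
        indicator_of_mem (hUΩ y hy)]
      change ρ y * (m ^ α * (γ x + γ y) * κ y) = _
      ring
    · filter_upwards [hsph] with y hy hyΩ
      have := hout y hy hyΩ.2
      simp only [localStatistic, if_pos hx]
      change ρ y * (m ^ α * _ * κ y) = 0
      rw [this, mul_zero, mul_zero]
  have e2 : m ^ α * (ε ^ d * ∫ z, η ‖z‖ * (Q (ε • z) * q z))
      = ∫ y in U, m ^ α * (Q (y - x) * κ y) := by
    rw [← integral_comp_inv_smul_sub hε x fun z => η ‖z‖ * (Q (ε • z) * q z), ← integral_const_mul]
    rw [setIntegral_eq_integral_of_ae_compl_eq_zero]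
    · refine integral_congr_ae (Filter.Eventually.of_forall fun y => ?_)
      simp only [hκ, norm_smul, norm_inv, Real.norm_of_nonneg hε.le, smul_inv_smul₀ hε.ne',
        inv_mul_eq_div]
      ring
    · filter_upwards [hsph] with y hy hyU
      rw [hout y hy hyU, mul_zero, mul_zero]
  have hUfin : volume U ≠ ⊤ := measure_ball_lt_top.ne
  -- B serves integrability only and does not enter the estimate.
  obtain ⟨B, hB⟩ : ∃ B, ∀ y ∈ U, |Q (y - x)| ≤ B := by
    obtain ⟨B, hB⟩ := (isCompact_closedBall (0 : EuclideanSpace ℝ (Fin d))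
      (2 * ε)).exists_bound_of_continuousOn hQ.continuousOn
    refine ⟨B, fun y hy => hB _ ?_⟩
    rw [mem_closedBall_zero_iff]
    exact (mem_ball_iff_norm.1 hy).le
  have hB0 : 0 ≤ B := (abs_nonneg _).trans (hB x hxU)
  have hT0 : 0 ≤ T := (abs_nonneg _).trans (hT x hxU)
  have hη0 := hη.zero_pos
  have hQm : Measurable fun y => Q (y - x) := hQ.measurable.comp (measurable_id.sub_const x)
  have i2 : IntegrableOn (fun y => m ^ α * (Q (y - x) * κ y)) U := by
    refine Measure.integrableOn_of_bounded (M := m ^ α * (B * (4 * η 0))) hUfin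
      ((hQm.mul hκm).const_mul _).aestronglyMeasurable
      ((ae_restrict_iff' hUm).2 (Filter.Eventually.of_forall fun y hy => ?_))
    rw [Real.norm_eq_abs, abs_mul, abs_mul, abs_of_pos (Real.rpow_pos_of_pos hm0 α)]
    gcongr
    · exact hB y hy
    · exact hκU y hy
  have hGm : AEStronglyMeasurable (fun y => m ^ α * (((γ x + γ y) * ρ y) * κ y))
      (volume.restrict U) := by
    have c1 : ContinuousOn γ U := fun y hy =>
      (hγ.contDiffAt hΩ (hUΩ y hy)).continuousAt.continuousWithinAt
    have c2 : ContinuousOn ρ U := hρ.differentiable.continuousOn.mono hball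
    exact ((((continuousOn_const.add c1).mul c2).aestronglyMeasurable hUm).mul
      hκm.aestronglyMeasurable).const_mul _
  have hGb : ∀ y ∈ U, |(γ x + γ y) * ρ y| ≤ T + B := fun y hy => by
    have := abs_add_le ((γ x + γ y) * ρ y - Q (y - x)) (Q (y - x))
    rw [sub_add_cancel] at this
    linarith [hT y hy, hB y hy]
  have i1 : IntegrableOn (fun y => m ^ α * (((γ x + γ y) * ρ y) * κ y)) U := by
    have : IsFiniteMeasure (volume.restrict U) := isFiniteMeasure_restrict.2 hUfin
    refine Integrable.of_bound hGm (m ^ α * ((T + B) * (4 * η 0)))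
      ((ae_restrict_iff' hUm).2 (Filter.Eventually.of_forall fun y hy => ?_))
    rw [Real.norm_eq_abs, abs_mul, abs_mul, abs_of_pos (Real.rpow_pos_of_pos hm0 α)]
    gcongr
    · exact hGb y hy
    · exact hκU y hy
  have hvol : volume.real U ≤
      volume.real (Metric.closedBall (0 : EuclideanSpace ℝ (Fin d)) 2) * ε ^ d := by
    have h1 : volume U ≤ volume (Metric.closedBall x (ε * 2)) := by
      rw [mul_comm ε]; exact measure_mono Metric.ball_subset_closedBall
    rw [Measure.addHaar_closedBall_mul volume x hε.le (by norm_num : (0 : ℝ) ≤ 2),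
      finrank_euclideanSpace_fin] at h1
    have h2 := ENNReal.toReal_mono
      (ENNReal.mul_ne_top ENNReal.ofReal_ne_top measure_closedBall_lt_top.ne) h1
    rw [ENNReal.toReal_mul, ENNReal.toReal_ofReal (by positivity), mul_comm] at h2
    exact h2
  rw [e1, e2, ← integral_sub i1 i2, ← Real.norm_eq_abs]
  refine (norm_setIntegral_le_of_norm_le_const (C := m ^ α * (T * (4 * η 0)))
    measure_ball_lt_top fun y hy => ?_).trans ?_
  · rw [← mul_sub, ← sub_mul, Real.norm_eq_abs, abs_mul, abs_mul,
      abs_of_pos (Real.rpow_pos_of_pos hm0 α)]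
    gcongr
    · exact hT y hy
    · exact hκU y hy
  · rw [mul_assoc]
    exact mul_le_mul_of_nonneg_left (mul_le_mul_of_nonneg_left hvol (by positivity))
      (Real.rpow_pos_of_pos hm0 α).le

end LocalStatistic

/-! ### From the graph Laplacian to empirical moments. -/

section Deterministic

variable {d : ℕ} {Ω : Set (EuclideanSpace ℝ (Fin d))} {Γ : Finset (EuclideanSpace ℝ (Fin d))}
  {r₀ α : ℝ} {η : ℝ → ℝ} {γ ρ : EuclideanSpace ℝ (Fin d) → ℝ}

theorem clm_apply_eq_sum {F : Type*} [NormedAddCommGroup F] [NormedSpace ℝ F]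
    (A : EuclideanSpace ℝ (Fin d) →L[ℝ] F) (v : EuclideanSpace ℝ (Fin d)) :
    A v = ∑ k, v k • A (EuclideanSpace.single k 1) := by
  conv_lhs => rw [← (EuclideanSpace.basisFun (Fin d) ℝ).sum_repr v]
  simp

theorem ckNorm_mono {k l : ℕ} (hkl : k ≤ l) (φ : EuclideanSpace ℝ (Fin d) → ℝ)
    (U : Set (EuclideanSpace ℝ (Fin d))) : ckNorm k φ U ≤ ckNorm l φ U :=
  Finset.sum_le_sum_of_subset (Finset.range_mono (by omega))

theorem norm_iteratedFDeriv_le_ckNorm {j k : ℕ} (hjk : j ≤ k)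
    {φ : EuclideanSpace ℝ (Fin d) → ℝ} {U : Set (EuclideanSpace ℝ (Fin d))}
    (hk : ckNorm k φ U ≠ ⊤) {y : EuclideanSpace ℝ (Fin d)} (hy : y ∈ U) :
    ‖iteratedFDeriv ℝ j φ y‖ ≤ (ckNorm k φ U).toReal := by
  rw [← toReal_enorm]
  refine ENNReal.toReal_mono hk ?_
  refine (le_iSup₂ (f := fun y (_ : y ∈ U) => ‖iteratedFDeriv ℝ j φ y‖ₑ) y hy).trans ?_
  exact Finset.single_le_sum (f := fun j => ⨆ y ∈ U, ‖iteratedFDeriv ℝ j φ y‖ₑ)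
    (fun _ _ => bot_le) (Finset.mem_range.2 (by omega))

/-- The profiles `1`, `z_k` and `z_k z_l` against which the empirical measure is tested. -/
def testProfile {d : ℕ} : Option (Fin d ⊕ Fin d × Fin d) → EuclideanSpace ℝ (Fin d) → ℝ
  | none, _ => 1
  | some (Sum.inl k), z => z k
  | some (Sum.inr (k, l)), z => z k * z l

theorem continuous_testProfile (s : Option (Fin d ⊕ Fin d × Fin d)) :
    Continuous (testProfile s) := by
  rcases s with _ | k | ⟨k, l⟩ <;> unfold testProfile <;> fun_prop

theorem abs_testProfile_le (s : Option (Fin d ⊕ Fin d × Fin d)) (z : EuclideanSpace ℝ (Fin d))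
    (hz : ‖z‖ ≤ 2) : |testProfile s z| ≤ 4 := by
  have h : ∀ k, |z k| ≤ 2 := fun k => (PiLp.norm_apply_le z k).trans hz
  rcases s with _ | k | ⟨k, l⟩
  · simp [testProfile]
  · exact (h k).trans (by norm_num)
  · change |z k * z l| ≤ 4
    rw [abs_mul]
    calc |z k| * |z l| ≤ 2 * 2 := mul_le_mul (h k) (h l) (abs_nonneg _) (by norm_num)
      _ = 4 := by norm_num

/-- All statistics share the nonnegative weight of the profile 1, so the Taylor remainder is
controlled by that single moment. -/
theorem localStatistic_testProfile (ε : ℝ) (q : EuclideanSpace ℝ (Fin d) → ℝ)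
    (x y : EuclideanSpace ℝ (Fin d)) :
    localStatistic Ω Γ η γ α ε q x y
      = localStatistic Ω Γ η γ α ε (testProfile none) x y * q (ε⁻¹ • (y - x)) := by
  unfold localStatistic
  split_ifs
  · simp only [testProfile]; ring
  · simp

theorem localStatistic_none_nonneg (hη : IsKernelProfile η) (hγ : IsPenaltyWeight Ω Γ r₀ α γ)
    {ε : ℝ} (hε : 0 < ε) (x y : EuclideanSpace ℝ (Fin d)) :
    0 ≤ localStatistic Ω Γ η γ α ε (testProfile none) x y := by
  have hi : ∀ z, 0 ≤ (Ω \ Γ).indicator γ z :=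
    indicator_nonneg fun z hz => zero_le_one.trans (hγ.one_le z hz)
  unfold localStatistic
  split_ifs with hx
  · have h1 : 0 ≤ (Metric.infDist x Γ - 2 * ε) ^ α := Real.rpow_nonneg (by linarith) _
    have h2 := hη.nonneg (by positivity : 0 ≤ ‖y - x‖ / ε)
    simp only [testProfile, mul_one]
    exact mul_nonneg (mul_nonneg h1 (add_nonneg (hi x) (hi y))) h2
  · exact le_rfl

/-- Points of Γ lie beyond the range of the kernel, and injectivity turns the sum over a `Finset`,
which merges ties, into a sum over indices. The factor M^{-α} undoes the normalisation of the
statistic. -/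
theorem graphLaplacian_eq (hη : IsKernelProfile η) {n : ℕ}
    {ε : ℝ} (hε : 0 < ε) {x : Fin n → EuclideanSpace ℝ (Fin d)} (hinj : Function.Injective x)
    (hxΩ : ∀ i, x i ∈ Ω) {i : Fin n} (hx : 2 * ε < Metric.infDist (x i) Γ)
    (φ : EuclideanSpace ℝ (Fin d) → ℝ) :
    graphLaplacian η γ n ε (vertices Γ x) φ (x i)
      = 1 / 2 * (ε ^ (d + 2))⁻¹ * (Metric.infDist (x i) Γ - 2 * ε) ^ (-α) * ((n : ℝ)⁻¹ *
        ∑ j, localStatistic Ω Γ η γ α ε (testProfile none) (x i) (x j) * (φ (x j) - φ (x i))) := by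
  classical
  set m := Metric.infDist (x i) Γ - 2 * ε with hm
  have hm0 : 0 < m := by linarith
  have hP : m ^ (-α) * m ^ α = 1 := by
    rw [← Real.rpow_add hm0, neg_add_cancel, Real.rpow_zero]
  have hker : ∀ y, 2 * ε < ‖y - x i‖ → η (‖y - x i‖ / ε) = 0 := fun y hy =>
    hη.eq_zero _ ((lt_div_iff₀ hε).2 hy)
  have hΓ0 : ∀ y ∈ Γ, η (‖y - x i‖ / ε) = 0 := fun y hy => hker y (by
    have := Metric.infDist_le_dist_of_mem (x := x i) (Finset.mem_coe.2 hy)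
    rw [dist_comm, dist_eq_norm] at this
    linarith)
  have hsum : ∑ y ∈ vertices Γ x, (γ (x i) + γ y) * scaledKernel η ε (x i - y) * (φ y - φ (x i))
      = ∑ j, (γ (x i) + γ (x j)) * scaledKernel η ε (x i - x j) * (φ (x j) - φ (x i)) := by
    rw [← Finset.sum_image (s := Finset.univ) (g := x)
      (f := fun y => (γ (x i) + γ y) * scaledKernel η ε (x i - y) * (φ y - φ (x i)))
      (hinj.injOn)]
    have hv : vertices Γ x = Finset.univ.image x ∪ Γ := by
      unfold vertices; congr
    rw [hv]
    refine (Finset.sum_subset Finset.subset_union_left fun y hy hy' => ?_).symm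
    have hyΓ : y ∈ Γ := (Finset.mem_union.1 hy).resolve_left hy'
    simp [scaledKernel, norm_sub_rev (x i) y, hΓ0 y hyΓ]
  have hterm : ∀ j, (γ (x i) + γ (x j)) * scaledKernel η ε (x i - x j) * (φ (x j) - φ (x i))
      = (ε ^ d)⁻¹ * m ^ (-α) *
        (localStatistic Ω Γ η γ α ε (testProfile none) (x i) (x j) * (φ (x j) - φ (x i))) := by
    intro j
    have hxi : x i ∈ Ω \ (Γ : Set (EuclideanSpace ℝ (Fin d))) :=
      ⟨hxΩ i, notMem_of_infDist_pos (by linarith)⟩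
    simp only [localStatistic, if_pos hx, indicator_of_mem hxi, testProfile, scaledKernel,
      norm_sub_rev (x i) (x j)]
    -- A sample point may lie in Γ, where the indicator replaces γ by zero; the kernel vanishes
    -- there anyway.
    by_cases hj : x j ∈ Γ
    · simp [hΓ0 _ hj]
    · rw [indicator_of_mem (show x j ∈ Ω \ (Γ : Set (EuclideanSpace ℝ (Fin d))) from ⟨hxΩ j, hj⟩)]
      change _ = (ε ^ d)⁻¹ * m ^ (-α) * (m ^ α * _ * _ * _)
      linear_combination (-((γ (x i) + γ (x j)) * (1 / ε ^ d * η (‖x j - x i‖ / ε))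
        * (φ (x j) - φ (x i)))) * hP
  rw [graphLaplacian, hsum, Finset.sum_congr rfl fun j _ => hterm j, ← Finset.mul_sum, pow_add]
  simp only [one_div, mul_inv]
  ring

/-- The constant part drops out by oddness, and the second moment matrix σ_η I picks out one
coefficient of l. -/
theorem integral_radial_affine_mul_coord [NeZero d] (hη : IsKernelProfile η) (a ε : ℝ)
    (l : EuclideanSpace ℝ (Fin d) →L[ℝ] ℝ) (k : Fin d) :
    ∫ z : EuclideanSpace ℝ (Fin d), η ‖z‖ * ((a + l (ε • z)) * z k)
      = ε * (kernelMoment d η * l (EuclideanSpace.single k 1)) := by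
  have hb : ∀ (z : EuclideanSpace ℝ (Fin d)), ‖z‖ ≤ 2 → ∀ k, |z k| ≤ 2 := fun z hz k =>
    (PiLp.norm_apply_le z k).trans hz
  have hm : ∀ k, Measurable fun z : EuclideanSpace ℝ (Fin d) => z k := fun k => by fun_prop
  have i1 : Integrable fun z : EuclideanSpace ℝ (Fin d) => η ‖z‖ * z k :=
    hη.integrable_mul (hm k) fun z hz => hb z hz k
  have i2 : ∀ j, Integrable fun z : EuclideanSpace ℝ (Fin d) => η ‖z‖ * (z j * z k) := fun j =>
    hη.integrable_mul ((hm j).mul (hm k)) (B := 2 * 2) fun z hz => by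
      rw [abs_mul]
      exact mul_le_mul (hb z hz j) (hb z hz k) (abs_nonneg _) (by norm_num)
  have e : ∀ z : EuclideanSpace ℝ (Fin d), η ‖z‖ * ((a + l (ε • z)) * z k)
      = a * (η ‖z‖ * z k) + ∑ j, ε * l (EuclideanSpace.single j 1) * (η ‖z‖ * (z j * z k)) := by
    intro z
    rw [map_smul, clm_apply_eq_sum l z]
    simp only [smul_eq_mul]
    rw [add_mul, mul_add, Finset.mul_sum, Finset.sum_mul, Finset.mul_sum]
    congr 1
    · ring
    · exact Finset.sum_congr rfl fun j _ => by ring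
  simp_rw [e]
  rw [integral_add (i1.const_mul _) (integrable_finsetSum _ fun j _ => (i2 j).const_mul _),
    integral_finsetSum _ fun j _ => (i2 j).const_mul _]
  simp_rw [integral_const_mul, integral_radial_mul_coord_mul_coord, integral_radial_mul_coord]
  simp
  ring

/-- Adds sampling error and bias: S is an empirical moment, E its expectation, e the power of ε of
its leading term, p = M^α, and G the limit. -/
theorem abs_half_div_sub_le {S E G T H p e δ ε : ℝ} (hp : 0 < p) (he : 0 < e)
    (h1 : |S - E| ≤ T * δ * e) (h2 : |E - p * e * G| ≤ p * H * e * ε) :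
    |1 / 2 * e⁻¹ * p⁻¹ * S - 1 / 2 * G| ≤ T * δ * p⁻¹ + H * ε := by
  have h3 : |S - p * e * G| ≤ T * δ * e + p * H * e * ε := by
    have := abs_add_le (S - E) (E - p * e * G)
    rw [sub_add_sub_cancel] at this
    linarith
  have e1 : 1 / 2 * e⁻¹ * p⁻¹ * S - 1 / 2 * G = 1 / 2 * (e⁻¹ * p⁻¹) * (S - p * e * G) := by
    field_simp
  have h0 := (abs_nonneg _).trans h3
  rw [e1, abs_mul, abs_of_pos (by positivity)]
  calc 1 / 2 * (e⁻¹ * p⁻¹) * |S - p * e * G|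
      ≤ 1 / 2 * (e⁻¹ * p⁻¹) * (T * δ * e + p * H * e * ε) := by gcongr
    _ ≤ 1 * (e⁻¹ * p⁻¹) * (T * δ * e + p * H * e * ε) := by gcongr; norm_num
    _ = _ := by field_simp

end Deterministic

/-! ### Consistency for configurations with good moments. -/

section DeterministicBound

variable {d : ℕ} {Ω : Set (EuclideanSpace ℝ (Fin d))} {Γ : Finset (EuclideanSpace ℝ (Fin d))}
  {r₀ α : ℝ} {η : ℝ → ℝ} {γ ρ : EuclideanSpace ℝ (Fin d) → ℝ}

/-- Taylor expansion of the tested empirical sum in terms of the empirical moments. -/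
theorem abs_sum_localStatistic_sub_le (hη : IsKernelProfile η) (hγ : IsPenaltyWeight Ω Γ r₀ α γ)
    {n : ℕ} {ε : ℝ} (hε : 0 < ε) {x : Fin n → EuclideanSpace ℝ (Fin d)}
    (hsph : ∀ i j, i ≠ j → ‖x j - x i‖ ≠ 2 * ε) (i : Fin n)
    {φ : EuclideanSpace ℝ (Fin d) → ℝ} (hφ : ContDiffOn ℝ 3 φ (Metric.ball (x i) (2 * ε)))
    {β : ℝ} (hβ0 : 0 ≤ β)
    (hβ : ∀ y ∈ Metric.ball (x i) (2 * ε), ‖iteratedFDeriv ℝ 3 φ y‖ ≤ β)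
    {S : Option (Fin d ⊕ Fin d × Fin d) → ℝ}
    (hS : ∀ s, S s = (n : ℝ)⁻¹ * ∑ j, localStatistic Ω Γ η γ α ε (testProfile s) (x i) (x j)) :
    |(n : ℝ)⁻¹ * ∑ j, localStatistic Ω Γ η γ α ε (testProfile none) (x i) (x j)
          * (φ (x j) - φ (x i))
        - (ε * ∑ k, fderiv ℝ φ (x i) (EuclideanSpace.single k 1) * S (some (Sum.inl k))
          + 1 / 2 * (ε ^ 2 * ∑ k, ∑ l, fderiv ℝ (fderiv ℝ φ) (x i) (EuclideanSpace.single k 1)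
            (EuclideanSpace.single l 1) * S (some (Sum.inr (k, l)))))|
      ≤ 8 * ε ^ 3 * β * S none := by
  set w : Fin n → ℝ := fun j => localStatistic Ω Γ η γ α ε (testProfile none) (x i) (x j) with hw
  have hw0 : ∀ j, 0 ≤ w j := fun j => localStatistic_none_nonneg hη hγ hε _ _
  set v : Fin n → EuclideanSpace ℝ (Fin d) := fun j => x j - x i with hv
  set z : Fin n → EuclideanSpace ℝ (Fin d) := fun j => ε⁻¹ • v j with hz
  have hvz : ∀ j k, v j k = ε * z j k := fun j k => by
    simp only [hz, PiLp.smul_apply, smul_eq_mul]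
    field_simp
  set U := Metric.ball (x i) (2 * ε) with hU
  have hxU : x i ∈ U := Metric.mem_ball_self (by linarith)
  set D1 := fderiv ℝ φ (x i) with hD1
  set D2 := fderiv ℝ (fderiv ℝ φ) (x i) with hD2
  set R : Fin n → ℝ := fun j => φ (x j) - φ (x i) - D1 (v j) - 1 / 2 * D2 (v j) (v j) with hR
  have hRle : ∀ j, |w j * R j| ≤ w j * (8 * ε ^ 3 * β) := fun j => by
    -- Taylor's formula applies in the open ball, with 8 = 2³, and the weight vanishes outside the
    -- closed one. On the sphere the kernel may be nonzero while φ is uncontrolled, so such points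
    -- must be excluded by `hsph`.
    rcases lt_trichotomy ‖v j‖ (2 * ε) with h | h | h
    · rw [abs_mul, abs_of_nonneg (hw0 j)]
      refine mul_le_mul_of_nonneg_left ?_ (hw0 j)
      have := abs_taylor_two_le (convex_ball _ _) Metric.isOpen_ball hφ hβ0 hβ hxU
        (mem_ball_iff_norm.2 h)
      refine this.trans ?_
      calc β * ‖v j‖ ^ 3 ≤ β * (2 * ε) ^ 3 := by gcongr
        _ = _ := by ring
    · exfalso
      by_cases hij : i = j
      · rw [hv, hij] at h
        simp only [sub_self, norm_zero] at h
        linarith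
      · exact hsph i j hij h
    · have : w j = 0 := localStatistic_eq_zero hη hε _ h
      rw [this]; simp
  have hexp : ∀ j, w j * (φ (x j) - φ (x i)) =
      ε * ∑ k, D1 (EuclideanSpace.single k 1)
          * localStatistic Ω Γ η γ α ε (testProfile (some (Sum.inl k))) (x i) (x j)
        + 1 / 2 * (ε ^ 2 * ∑ k, ∑ l, D2 (EuclideanSpace.single k 1) (EuclideanSpace.single l 1)
          * localStatistic Ω Γ η γ α ε (testProfile (some (Sum.inr (k, l)))) (x i) (x j))
        + w j * R j := by
    intro j
    have h1 : D1 (v j) = ε * ∑ k, D1 (EuclideanSpace.single k 1) * z j k := by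
      rw [clm_apply_eq_sum D1, Finset.mul_sum]
      exact Finset.sum_congr rfl fun k _ => by rw [hvz, smul_eq_mul]; ring
    have h2 : D2 (v j) (v j) = ε ^ 2 * ∑ k, ∑ l,
        D2 (EuclideanSpace.single k 1) (EuclideanSpace.single l 1) * (z j k * z j l) := by
      rw [clm_apply_eq_sum D2 (v j), sum_apply, Finset.mul_sum]
      refine Finset.sum_congr rfl fun k _ => ?_
      rw [smul_apply, clm_apply_eq_sum _ (v j), smul_eq_mul, Finset.mul_sum,
        Finset.mul_sum]
      exact Finset.sum_congr rfl fun l _ => by rw [hvz, hvz, smul_eq_mul]; ring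
    have h3 : ∀ s, localStatistic Ω Γ η γ α ε (testProfile s) (x i) (x j)
        = w j * testProfile s (z j) := fun s => localStatistic_testProfile ε _ _ _
    simp_rw [h3]
    have e : φ (x j) - φ (x i) = D1 (v j) + 1 / 2 * D2 (v j) (v j) + R j := by
      simp only [hR]; ring
    rw [e, h1, h2]
    simp only [testProfile]
    have e1 : ∑ k, D1 (EuclideanSpace.single k 1) * (w j * z j k)
        = w j * ∑ k, D1 (EuclideanSpace.single k 1) * z j k := by
      rw [Finset.mul_sum]; exact Finset.sum_congr rfl fun k _ => by ring
    have e2 : ∑ k, ∑ l, D2 (EuclideanSpace.single k 1) (EuclideanSpace.single l 1)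
          * (w j * (z j k * z j l))
        = w j * ∑ k, ∑ l, D2 (EuclideanSpace.single k 1) (EuclideanSpace.single l 1)
          * (z j k * z j l) := by
      simp_rw [Finset.mul_sum]
      exact Finset.sum_congr rfl fun k _ => Finset.sum_congr rfl fun l _ => by ring
    rw [e1, e2]
    ring
  have hmain : (n : ℝ)⁻¹ * ∑ j, w j * (φ (x j) - φ (x i))
      - (ε * ∑ k, D1 (EuclideanSpace.single k 1) * S (some (Sum.inl k))
          + 1 / 2 * (ε ^ 2 * ∑ k, ∑ l, D2 (EuclideanSpace.single k 1)
            (EuclideanSpace.single l 1) * S (some (Sum.inr (k, l)))))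
      = (n : ℝ)⁻¹ * ∑ j, w j * R j := by
    rw [Finset.sum_congr rfl fun j _ => hexp j, Finset.sum_add_distrib, Finset.sum_add_distrib,
      ← Finset.mul_sum, ← Finset.mul_sum, ← Finset.mul_sum]
    have e1 : ∑ j, ∑ k, D1 (EuclideanSpace.single k 1)
          * localStatistic Ω Γ η γ α ε (testProfile (some (Sum.inl k))) (x i) (x j)
        = ∑ k, D1 (EuclideanSpace.single k 1) *
          ∑ j, localStatistic Ω Γ η γ α ε (testProfile (some (Sum.inl k))) (x i) (x j) := by
      rw [Finset.sum_comm]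
      exact Finset.sum_congr rfl fun k _ => (Finset.mul_sum _ _ _).symm
    have e2 : ∑ j, ∑ k, ∑ l, D2 (EuclideanSpace.single k 1) (EuclideanSpace.single l 1)
          * localStatistic Ω Γ η γ α ε (testProfile (some (Sum.inr (k, l)))) (x i) (x j)
        = ∑ k, ∑ l, D2 (EuclideanSpace.single k 1) (EuclideanSpace.single l 1) *
          ∑ j, localStatistic Ω Γ η γ α ε (testProfile (some (Sum.inr (k, l)))) (x i) (x j) := by
      rw [Finset.sum_comm]
      refine Finset.sum_congr rfl fun k _ => ?_
      rw [Finset.sum_comm]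
      exact Finset.sum_congr rfl fun l _ => (Finset.mul_sum _ _ _).symm
    have e3 : ∑ k, D1 (EuclideanSpace.single k 1) * S (some (Sum.inl k)) = (n : ℝ)⁻¹ *
        ∑ k, D1 (EuclideanSpace.single k 1) *
          ∑ j, localStatistic Ω Γ η γ α ε (testProfile (some (Sum.inl k))) (x i) (x j) := by
      rw [Finset.mul_sum]
      exact Finset.sum_congr rfl fun k _ => by rw [hS]; ring
    have e4 : ∑ k, ∑ l, D2 (EuclideanSpace.single k 1) (EuclideanSpace.single l 1)
          * S (some (Sum.inr (k, l))) = (n : ℝ)⁻¹ *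
        ∑ k, ∑ l, D2 (EuclideanSpace.single k 1) (EuclideanSpace.single l 1) *
          ∑ j, localStatistic Ω Γ η γ α ε (testProfile (some (Sum.inr (k, l)))) (x i) (x j) := by
      rw [Finset.mul_sum]
      refine Finset.sum_congr rfl fun k _ => ?_
      rw [Finset.mul_sum]
      exact Finset.sum_congr rfl fun l _ => by rw [hS]; ring
    rw [e1, e2, e3, e4]
    ring
  rw [hmain, abs_mul, abs_of_nonneg (by positivity : (0 : ℝ) ≤ (n : ℝ)⁻¹), hS none]
  calc (n : ℝ)⁻¹ * |∑ j, w j * R j| ≤ (n : ℝ)⁻¹ * ∑ j, w j * (8 * ε ^ 3 * β) := by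
        gcongr
        exact (Finset.abs_sum_le_sum_abs _ _).trans (Finset.sum_le_sum fun j _ => hRle j)
    _ = _ := by rw [← Finset.sum_mul]; ring

/-- The consistency estimate holds for every configuration without ties whose empirical moments
are close to their expectations. -/
theorem exists_const_consistencyHolds [NeZero d] (hΩ : IsOpen Ω) (hΩb : Bornology.IsBounded Ω)
    (hΓne : Γ.Nonempty) (hΓ : (Γ : Set (EuclideanSpace ℝ (Fin d))) ⊆ Ω) (hρ : IsDataDensity Ω ρ)
    (hη : IsKernelProfile η) (hr₀ : 0 < r₀) (hα : 0 ≤ α) (hγ : IsPenaltyWeight Ω Γ r₀ α γ)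
    {T : ℝ} (hT : 0 ≤ T) :
    ∃ C : ℝ, 0 < C ∧ ∀ (n : ℕ) (ε δ : ℝ) (x : Fin n → EuclideanSpace ℝ (Fin d)),
      0 < ε → ε ≤ δ → δ ≤ 1 → Function.Injective x →
      (∀ i j, i ≠ j → ‖x j - x i‖ ≠ 2 * ε) → (∀ i, x i ∈ Ω) →
      (∀ s i, |(n : ℝ)⁻¹ * ∑ j, localStatistic Ω Γ η γ α ε (testProfile s) (x i) (x j)
        - ∫ y, localStatistic Ω Γ η γ α ε (testProfile s) (x i) y ∂(dataMeasure Ω ρ)|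
          ≤ T * δ * ε ^ (d + 1)) →
      ConsistencyHolds Ω Γ η γ ρ α C n ε δ x := by
  obtain ⟨K, hK0, hK⟩ := hγ.exists_bound hΩ hΩb hΓne hΓ hr₀ hα
  obtain ⟨L, hL0, hL, hL2⟩ := hρ.exists_bound hΩb hΩ
  obtain ⟨D, hD1, hD⟩ : ∃ D : ℝ, 1 ≤ D ∧ ∀ y ∈ Ω, Metric.infDist y Γ ≤ D := by
    obtain ⟨D, hD⟩ := Metric.isBounded_iff.1 hΩb
    obtain ⟨p, hp⟩ := hΓne
    exact ⟨max 1 D, le_max_left _ _, fun y hy =>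
      (Metric.infDist_le_dist_of_mem (Finset.mem_coe.2 hp)).trans
        ((hD hy (hΓ hp)).trans (le_max_right _ _))⟩
  have hη0 := hη.zero_pos
  set V := volume.real (Metric.closedBall (0 : EuclideanSpace ℝ (Fin d)) 2) with hV
  have hV0 : 0 ≤ V := measureReal_nonneg
  set B := 8 * K * η 0 with hB
  set Kc := K * L * (4 + 4 * D + 8 * D ^ 2) with hKc
  have hKc0 : 0 ≤ Kc := by positivity
  set h := Kc * (4 * η 0) * V with hh
  have hh0 : 0 ≤ h := by positivity
  -- T marks sampling errors and h biases, with d first and d² second moments; the term with factor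
  -- 4 is the Taylor remainder, and 1 ensures positivity.
  refine ⟨d * T + d * h + d ^ 2 * T + d ^ 2 * h + 4 * (B * (L * V) + T) + 1, by positivity, ?_⟩
  intro n ε δ x hε hεδ hδ hinj hsph hxΩ hdev i hx _ hball φ hφ
  set m := Metric.infDist (x i) Γ - 2 * ε with hm
  have hm0 : 0 < m := by linarith
  set U := Metric.ball (x i) (2 * ε) with hU
  have hxU : x i ∈ U := Metric.mem_ball_self (by linarith)
  have hUo : IsOpen U := Metric.isOpen_ball
  have hxi : x i ∈ Ω \ (Γ : Set (EuclideanSpace ℝ (Fin d))) :=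
    ⟨hxΩ i, notMem_of_infDist_pos (by linarith)⟩
  have hδ0 : 0 < δ := hε.trans_le hεδ
  obtain ⟨hφ3, hfin⟩ := hφ
  set β : ℕ → ℝ := fun k => (ckNorm k φ U).toReal with hβ
  have hβ0 : ∀ k, 0 ≤ β k := fun k => ENNReal.toReal_nonneg
  have hkfin : ∀ k ≤ 3, ckNorm k φ U ≠ ⊤ := fun k hk => ne_top_of_le_ne_top hfin (ckNorm_mono hk _ _)
  have hβ3 : ∀ k ≤ 3, β k ≤ β 3 := fun k hk => ENNReal.toReal_mono hfin (ckNorm_mono hk _ _)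
  set p := m ^ α with hp
  have hp0 : 0 < p := Real.rpow_pos_of_pos hm0 _
  have hpinv : m ^ (-α) = p⁻¹ := Real.rpow_neg hm0.le α
  set m1 := m ^ (-(α + 1)) with hm1
  set m2 := m ^ (-(α + 2)) with hm2
  have hm10 : 0 < m1 := Real.rpow_pos_of_pos hm0 _
  have hm20 : 0 < m2 := Real.rpow_pos_of_pos hm0 _
  have hexp := fun y hy => abs_weight_sub_le hΩ hγ hα hD1 hD hK0 hK hL0 hL hρ hL2 hε hx hball
    (y := y) hy
  set S : Option (Fin d ⊕ Fin d × Fin d) → ℝ := fun s =>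
    (n : ℝ)⁻¹ * ∑ j, localStatistic Ω Γ η γ α ε (testProfile s) (x i) (x j) with hS
  set l : EuclideanSpace ℝ (Fin d) →L[ℝ] ℝ :=
    ρ (x i) • fderiv ℝ γ (x i) + (2 * γ (x i)) • fderiv ℝ ρ (x i) with hl
  set σ := kernelMoment d η with hσ
  set D1 := fderiv ℝ φ (x i) with hDD1
  set D2 := fderiv ℝ (fderiv ℝ φ) (x i) with hDD2
  set c0 := 1 / 2 * (ε ^ (d + 2))⁻¹ * p⁻¹ with hc0
  have hc00 : 0 < c0 := by positivity
  have hε1 : ε ≤ 1 := hεδ.trans hδ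
  -- first moments
  have hA : ∀ k, |c0 * ε * S (some (Sum.inl k)) - 1 / 2 * (σ * l (EuclideanSpace.single k 1))|
      ≤ T * δ * p⁻¹ + h * m2 * ε := fun k => by
    have h1 := abs_integral_localStatistic_sub_le hΩ hη hγ hρ hε
      (continuous_testProfile (some (Sum.inl k))).measurable (abs_testProfile_le _) hx hball
      (Q := fun v => 2 * γ (x i) * ρ (x i) + l v) (by fun_prop) (T := Kc * m2 * ε ^ 2)
      (fun y hy => (hexp y hy).2)
    simp only [testProfile] at h1
    rw [integral_radial_affine_mul_coord hη] at h1
    -- The leading term of order ε^d is odd and vanishes, so first moments live at order ε^{d+1}.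
    -- This forces deviations as small as δε^{d+1}.
    have h2 := abs_half_div_sub_le (S := S (some (Sum.inl k))) hp0
      (by positivity : 0 < ε ^ (d + 1)) (hdev (some (Sum.inl k)) i)
      (G := σ * l (EuclideanSpace.single k 1)) (H := h * m2) (ε := ε) (by
        refine le_trans (le_of_eq ?_) (h1.trans (le_of_eq ?_))
        · congr 1; ring
        · rw [hh]; ring)
    refine le_trans (le_of_eq ?_) h2
    congr 2
    rw [hc0]
    field_simp
    ring
  -- second moments
  have hBm : ∀ k l', |c0 * ε ^ 2 * S (some (Sum.inr (k, l')))
        - 1 / 2 * (2 * γ (x i) * ρ (x i) * if k = l' then σ else 0)|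
      ≤ T * (δ * ε) * p⁻¹ + h * m1 * ε := fun k l' => by
    have h1 := abs_integral_localStatistic_sub_le hΩ hη hγ hρ hε
      (continuous_testProfile (some (Sum.inr (k, l')))).measurable (abs_testProfile_le _) hx hball
      (Q := fun _ => 2 * γ (x i) * ρ (x i)) (by fun_prop) (T := Kc * m1 * ε)
      (fun y hy => (hexp y hy).1)
    have e : ∀ z : EuclideanSpace ℝ (Fin d), η ‖z‖ * (2 * γ (x i) * ρ (x i) * (z k * z l'))
        = 2 * γ (x i) * ρ (x i) * (η ‖z‖ * (z k * z l')) := fun z => by ring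
    simp only [testProfile] at h1
    simp_rw [e] at h1
    rw [integral_const_mul, integral_radial_mul_coord_mul_coord] at h1
    -- Second moments live at order ε^d, so the same deviation bound is a relative error δε, better
    -- than needed.
    have h2 := abs_half_div_sub_le (S := S (some (Sum.inr (k, l')))) hp0
      (by positivity : 0 < ε ^ d) (δ := δ * ε) (T := T)
      ((hdev (some (Sum.inr (k, l'))) i).trans_eq (by ring))
      (G := 2 * γ (x i) * ρ (x i) * if k = l' then σ else 0) (H := h * m1) (ε := ε) (by
        refine le_trans (le_of_eq ?_) (h1.trans (le_of_eq ?_))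
        · congr 1; ring
        · rw [hh]; ring)
    refine le_trans (le_of_eq ?_) h2
    congr 2
    rw [hc0]
    field_simp
    ring
  -- total mass
  have hS1 : S none ≤ (B * (L * V) + T) * ε ^ d := by
    have h1 := abs_integral_dataMeasure_le hΩ hρ hL0.le (fun y hy => (hL y hy).2.1) hε
      (abs_localStatistic_le (Ω := Ω) (γ := γ) hη hα hK0 hK hε (abs_testProfile_le none) (x i))
      (fun y hy => localStatistic_eq_zero hη hε _ hy)
    have h2 := hdev none i
    have h3 : T * δ * ε ^ (d + 1) ≤ T * ε ^ d := by
      rw [mul_assoc]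
      refine mul_le_mul_of_nonneg_left ?_ hT
      rw [pow_succ, ← mul_assoc]
      calc δ * ε ^ d * ε ≤ 1 * ε ^ d * 1 := by gcongr
        _ = _ := by ring
    have h4 := (abs_le.1 h1).2
    have h5 := (abs_le.1 h2).2
    change S none - _ ≤ _ at h5
    calc S none ≤ B * (L * V * ε ^ d) + T * ε ^ d := by linarith
      _ = _ := by ring
  have hS1' : c0 * (8 * ε ^ 3 * β 3 * S none) ≤ 4 * (B * (L * V) + T) * (ε * p⁻¹ * β 3) := by
    calc c0 * (8 * ε ^ 3 * β 3 * S none)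
        ≤ c0 * (8 * ε ^ 3 * β 3 * ((B * (L * V) + T) * ε ^ d)) := by
          have := hβ0 3
          gcongr
      _ = _ := by rw [hc0]; field_simp; ring
  have hrem := abs_sum_localStatistic_sub_le hη hγ hε hsph i hφ3 (hβ0 3)
    (fun y hy => norm_iteratedFDeriv_le_ckNorm le_rfl hfin hy) (S := S) (fun s => rfl)
  have hγd : DifferentiableAt ℝ γ (x i) := (hγ.contDiffAt hΩ hxi).differentiableAt (by simp)
  have hρd : DifferentiableAt ℝ ρ (x i) :=
    (hρ.differentiable _ (hxΩ i)).differentiableAt (hΩ.mem_nhds (hxΩ i))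
  have hφd : DifferentiableAt ℝ (fderiv ℝ φ) (x i) :=
    ((hφ3.contDiffAt (hUo.mem_nhds hxU)).fderiv_right (m := 2) (by norm_num)).differentiableAt
      (by simp)
  have hnorm : ∀ k : Fin d, ‖(EuclideanSpace.single k 1 : EuclideanSpace ℝ (Fin d))‖ = 1 :=
    fun k => by simp
  have hD1k : ∀ k, |D1 (EuclideanSpace.single k 1)| ≤ β 1 := fun k => by
    have h1 := D1.le_opNorm (EuclideanSpace.single k 1)
    rw [hnorm, mul_one, hDD1, ← norm_iteratedFDeriv_one] at h1
    exact h1.trans (norm_iteratedFDeriv_le_ckNorm le_rfl (hkfin 1 (by norm_num)) hxU)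
  have hD2k : ∀ k l', |D2 (EuclideanSpace.single k 1) (EuclideanSpace.single l' 1)| ≤ β 2 :=
    fun k l' => by
      have h1 := D2.le_opNorm₂ (EuclideanSpace.single k 1) (EuclideanSpace.single l' 1)
      rw [hnorm, hnorm, mul_one, mul_one, hDD2, ← norm_iteratedFDeriv_two] at h1
      exact h1.trans (norm_iteratedFDeriv_le_ckNorm le_rfl (hkfin 2 (by norm_num)) hxU)
  rw [graphLaplacian_eq (α := α) hη hε hinj hxΩ hx φ,
    weightedLaplacian_eq hγd hρd (hL _ (hxΩ i)).1.ne' hφd, hpinv]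
  set W := (n : ℝ)⁻¹ * ∑ j, localStatistic Ω Γ η γ α ε (testProfile none) (x i) (x j)
          * (φ (x j) - φ (x i)) with hW
  set Y := ε * ∑ k, D1 (EuclideanSpace.single k 1) * S (some (Sum.inl k))
          + 1 / 2 * (ε ^ 2 * ∑ k, ∑ l, D2 (EuclideanSpace.single k 1)
            (EuclideanSpace.single l 1) * S (some (Sum.inr (k, l)))) with hY
  -- The error splits into the Taylor remainder, the errors of the first moments and those of the
  -- second moments.
  have hdecomp : c0 * W - 1 / 2 * σ * (∑ k, D1 (EuclideanSpace.single k 1) *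
        (ρ (x i) * fderiv ℝ γ (x i) (EuclideanSpace.single k 1)
          + 2 * γ (x i) * fderiv ℝ ρ (x i) (EuclideanSpace.single k 1))
      + γ (x i) * ρ (x i) * ∑ k, D2 (EuclideanSpace.single k 1) (EuclideanSpace.single k 1))
      = c0 * (W - Y)
        + ∑ k, D1 (EuclideanSpace.single k 1) * (c0 * ε * S (some (Sum.inl k))
            - 1 / 2 * (σ * l (EuclideanSpace.single k 1)))
        + 1 / 2 * ∑ k, ∑ l', D2 (EuclideanSpace.single k 1) (EuclideanSpace.single l' 1) *
            (c0 * ε ^ 2 * S (some (Sum.inr (k, l')))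
              - 1 / 2 * (2 * γ (x i) * ρ (x i) * if k = l' then σ else 0)) := by
    simp only [mul_sub, Finset.sum_sub_distrib, hY]
    have e1 : ∑ k, D1 (EuclideanSpace.single k 1) * (c0 * ε * S (some (Sum.inl k)))
        = c0 * ε * ∑ k, D1 (EuclideanSpace.single k 1) * S (some (Sum.inl k)) := by
      rw [Finset.mul_sum]; exact Finset.sum_congr rfl fun k _ => by ring
    have e2 : ∑ k, ∑ l', D2 (EuclideanSpace.single k 1) (EuclideanSpace.single l' 1)
          * (c0 * ε ^ 2 * S (some (Sum.inr (k, l'))))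
        = c0 * ε ^ 2 * ∑ k, ∑ l', D2 (EuclideanSpace.single k 1) (EuclideanSpace.single l' 1)
          * S (some (Sum.inr (k, l'))) := by
      simp_rw [Finset.mul_sum]
      exact Finset.sum_congr rfl fun k _ => Finset.sum_congr rfl fun l' _ => by ring
    have e3 : ∑ k, ∑ l', D2 (EuclideanSpace.single k 1) (EuclideanSpace.single l' 1)
          * (1 / 2 * (2 * γ (x i) * ρ (x i) * if k = l' then σ else 0))
        = σ * (γ (x i) * ρ (x i)) *
          ∑ k, D2 (EuclideanSpace.single k 1) (EuclideanSpace.single k 1) := by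
      rw [Finset.mul_sum]
      refine Finset.sum_congr rfl fun k _ => ?_
      simp only [mul_ite, mul_zero, Finset.sum_ite_eq, Finset.mem_univ, if_true]
      ring
    have e4 : ∑ k, D1 (EuclideanSpace.single k 1) *
          (1 / 2 * (σ * l (EuclideanSpace.single k 1)))
        = 1 / 2 * σ * ∑ k, D1 (EuclideanSpace.single k 1) *
        (ρ (x i) * fderiv ℝ γ (x i) (EuclideanSpace.single k 1)
          + 2 * γ (x i) * fderiv ℝ ρ (x i) (EuclideanSpace.single k 1)) := by
      rw [Finset.mul_sum]
      refine Finset.sum_congr rfl fun k _ => ?_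
      simp only [hl, add_apply, smul_apply, smul_eq_mul]
      ring
    rw [e1, e2, e3, e4]
    ring
  have hb1 : |∑ k, D1 (EuclideanSpace.single k 1) * (c0 * ε * S (some (Sum.inl k))
            - 1 / 2 * (σ * l (EuclideanSpace.single k 1)))|
      ≤ d * (β 1 * (T * δ * p⁻¹ + h * m2 * ε)) := by
    refine (Finset.abs_sum_le_sum_abs _ _).trans ((Finset.sum_le_card_nsmul _ _
      (β 1 * (T * δ * p⁻¹ + h * m2 * ε)) fun k _ => ?_).trans_eq (by simp))
    rw [abs_mul]
    exact mul_le_mul (hD1k k) (hA k) (abs_nonneg _) (hβ0 1)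
  have hb2 : |∑ k, ∑ l', D2 (EuclideanSpace.single k 1) (EuclideanSpace.single l' 1) *
            (c0 * ε ^ 2 * S (some (Sum.inr (k, l')))
              - 1 / 2 * (2 * γ (x i) * ρ (x i) * if k = l' then σ else 0))|
      ≤ d * (d * (β 2 * (T * (δ * ε) * p⁻¹ + h * m1 * ε))) := by
    refine (Finset.abs_sum_le_sum_abs _ _).trans ((Finset.sum_le_card_nsmul _ _
      (d * (β 2 * (T * (δ * ε) * p⁻¹ + h * m1 * ε))) fun k _ => ?_).trans_eq (by simp))
    refine (Finset.abs_sum_le_sum_abs _ _).trans ((Finset.sum_le_card_nsmul _ _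
      (β 2 * (T * (δ * ε) * p⁻¹ + h * m1 * ε)) fun l' _ => ?_).trans_eq (by simp))
    rw [abs_mul]
    exact mul_le_mul (hD2k k l') (hBm k l') (abs_nonneg _) (hβ0 2)
  have hb0 : |c0 * (W - Y)| ≤ 4 * (B * (L * V) + T) * (ε * p⁻¹ * β 3) := by
    rw [abs_mul, abs_of_pos hc00]
    exact (mul_le_mul_of_nonneg_left hrem hc00.le).trans hS1'
  rw [hdecomp]
  have herr : consistencyError Γ α ε δ φ (x i)
      = (ε * β 1 + ε ^ 2 * β 2) * m2 + ε * β 2 * m1 + δ * β 3 * p⁻¹ := by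
    rw [← hpinv]; rfl
  rw [herr]
  have b1 := hβ0 1
  have b2 := hβ0 2
  have b3 := hβ0 3
  have b13 := hβ3 1 (by norm_num)
  have b23 := hβ3 2 (by norm_num)
  set Err := (ε * β 1 + ε ^ 2 * β 2) * m2 + ε * β 2 * m1 + δ * β 3 * p⁻¹ with hErr
  have q1 : ε * β 1 * m2 ≤ Err := by
    have : 0 ≤ ε ^ 2 * β 2 * m2 + ε * β 2 * m1 + δ * β 3 * p⁻¹ := by positivity
    rw [hErr]; linarith
  have q2 : ε * β 2 * m1 ≤ Err := by
    have : 0 ≤ (ε * β 1 + ε ^ 2 * β 2) * m2 + δ * β 3 * p⁻¹ := by positivity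
    rw [hErr]; linarith
  have q3 : δ * β 3 * p⁻¹ ≤ Err := by
    have : 0 ≤ (ε * β 1 + ε ^ 2 * β 2) * m2 + ε * β 2 * m1 := by positivity
    rw [hErr]; linarith
  have q0 : 0 ≤ Err := le_trans (by positivity) q3
  -- Sampling errors come with β₁ and β₂, which are absorbed into β₃ because C^k norms increase with
  -- k.
  have q4 : δ * p⁻¹ * β 1 ≤ Err := le_trans (by
    calc δ * p⁻¹ * β 1 ≤ δ * p⁻¹ * β 3 := by gcongr
      _ = δ * β 3 * p⁻¹ := by ring) q3
  have q5 : δ * ε * p⁻¹ * β 2 ≤ Err := le_trans (by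
    calc δ * ε * p⁻¹ * β 2 ≤ δ * 1 * p⁻¹ * β 3 := by gcongr
      _ = δ * β 3 * p⁻¹ := by ring) q3
  have q6 : ε * p⁻¹ * β 3 ≤ Err := le_trans (by
    calc ε * p⁻¹ * β 3 ≤ δ * p⁻¹ * β 3 := by gcongr
      _ = δ * β 3 * p⁻¹ := by ring) q3
  have hBLV : 0 ≤ B * (L * V) + T := by positivity
  calc |c0 * (W - Y) + _ + 1 / 2 * _|
      ≤ 4 * (B * (L * V) + T) * (ε * p⁻¹ * β 3) + d * (β 1 * (T * δ * p⁻¹ + h * m2 * ε))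
          + 1 * (d * (d * (β 2 * (T * (δ * ε) * p⁻¹ + h * m1 * ε)))) := by
        refine (abs_add_three _ _ _).trans (add_le_add (add_le_add hb0 hb1) ?_)
        rw [abs_mul]
        exact mul_le_mul (by norm_num [abs_of_pos]) hb2 (abs_nonneg _) (by norm_num)
    _ = 4 * (B * (L * V) + T) * (ε * p⁻¹ * β 3) + d * T * (δ * p⁻¹ * β 1)
          + d * h * (ε * β 1 * m2) + d ^ 2 * T * (δ * ε * p⁻¹ * β 2)
          + d ^ 2 * h * (ε * β 2 * m1) := by ring
    _ ≤ 4 * (B * (L * V) + T) * Err + d * T * Err + d * h * Err + d ^ 2 * T * Err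
          + d ^ 2 * h * Err := by gcongr
    _ ≤ _ := by linarith

end DeterministicBound

/-! ### Probability of the good event. -/

section Probability

variable {d : ℕ} {Ω : Set (EuclideanSpace ℝ (Fin d))} {Γ : Finset (EuclideanSpace ℝ (Fin d))}
  {r₀ α : ℝ} {η : ℝ → ℝ} {γ ρ : EuclideanSpace ℝ (Fin d) → ℝ}

/-- A sample almost surely has no ties, no two points at distance exactly `r`, and lies in `Ω`. -/
theorem ae_pi_dataMeasure_generic [NeZero d] (hΩ : IsOpen Ω) (hρ : IsDataDensity Ω ρ) (n : ℕ)
    (r : ℝ) :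
    ∀ᵐ x ∂(Measure.pi fun _ : Fin n => dataMeasure Ω ρ), Function.Injective x ∧
      (∀ i j, i ≠ j → ‖x j - x i‖ ≠ r) ∧ ∀ i, x i ∈ Ω := by
  have := hρ.isProbability
  have hc : Continuous fun p : EuclideanSpace ℝ (Fin d) × EuclideanSpace ℝ (Fin d) =>
      ‖p.2 - p.1‖ := by fun_prop
  have hsec : ∀ r x, dataMeasure Ω ρ
      {y | (x, y) ∈ {p : EuclideanSpace ℝ (Fin d) × EuclideanSpace ℝ (Fin d) | ‖p.2 - p.1‖ = r}}
        = 0 := fun r x => by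
    have e : {y | (x, y) ∈ {p : EuclideanSpace ℝ (Fin d) × EuclideanSpace ℝ (Fin d) |
        ‖p.2 - p.1‖ = r}} = Metric.sphere x r := by
      ext y; simp [mem_sphere_iff_norm]
    rw [e]
    exact dataMeasure_null hΩ hρ Metric.isClosed_sphere.measurableSet
      (Measure.addHaar_sphere volume x r)
  have hpair := fun r => ae_pi_pairwise_of_sections (μ := dataMeasure Ω ρ)
    (isClosed_eq hc (continuous_const (y := r))).measurableSet (hsec r) n
  have hmem : ∀ᵐ x ∂(Measure.pi fun _ : Fin n => dataMeasure Ω ρ), ∀ i, x i ∈ Ω := by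
    refine ae_all_iff.2 fun i => ?_
    have h0 : ∀ᵐ y ∂(dataMeasure Ω ρ), y ∈ Ω := by
      rw [ae_iff]
      exact dataMeasure_compl hΩ
    exact (measurePreserving_eval (fun _ : Fin n => dataMeasure Ω ρ)
      i).quasiMeasurePreserving.ae h0
  filter_upwards [hpair 0, hpair r, hmem] with x h0 hr hm
  refine ⟨fun i j hij => ?_, fun i j hij => hr i j hij, hm⟩
  by_contra hne
  exact h0 i j hne (by simp [hij])

/-- Large deviations of the empirical moments. -/
theorem exists_const_deviation_le (hΩ : IsOpen Ω) (hΩb : Bornology.IsBounded Ω)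
    (hΓne : Γ.Nonempty) (hΓ : (Γ : Set (EuclideanSpace ℝ (Fin d))) ⊆ Ω) (hρ : IsDataDensity Ω ρ)
    (hη : IsKernelProfile η) (hr₀ : 0 < r₀) (hα : 0 ≤ α) (hγ : IsPenaltyWeight Ω Γ r₀ α γ) :
    ∃ T c : ℝ, 0 ≤ T ∧ 0 < c ∧ ∀ (n : ℕ) (ε δ : ℝ), 0 < ε → ε ≤ δ → δ ≤ 1 →
      1 ≤ δ ^ 2 * n * ε ^ (d + 2) → ∀ s,
      (Measure.pi fun _ : Fin n => dataMeasure Ω ρ).real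
        {x | ∃ i, T * δ * ε ^ (d + 1) <
          |(n : ℝ)⁻¹ * ∑ j, localStatistic Ω Γ η γ α ε (testProfile s) (x i) (x j)
            - ∫ y, localStatistic Ω Γ η γ α ε (testProfile s) (x i) y ∂(dataMeasure Ω ρ)|}
        ≤ 2 * n * Real.exp (-c * δ ^ 2 * n * ε ^ (d + 2)) := by
  have := hρ.isProbability
  obtain ⟨K, hK0, hK⟩ := hγ.exists_bound hΩ hΩb hΓne hΓ hr₀ hα
  obtain ⟨L, hL0, hL, -⟩ := hρ.exists_bound hΩb hΩ
  have hη0 := hη.zero_pos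
  set B := 8 * K * η 0 with hB
  have hB0 : 0 < B := by positivity
  set V := B ^ 2 * (L * volume.real (Metric.closedBall (0 : EuclideanSpace ℝ (Fin d)) 2)) with hV
  have hV0 : 0 ≤ V := mul_nonneg (sq_nonneg B) (mul_nonneg hL0.le measureReal_nonneg)
  set k := 2 * V + 2 * B with hk
  have hk0 : 0 < k := by positivity
  -- In T = 1 + 2B, the 1 is for the terms j ≠ i, handled by Bernstein, and 2B for the diagonal term
  -- j = i.
  refine ⟨1 + 2 * B, 1 / (2 * k), by positivity, by positivity,
    fun n ε δ hε hεδ hδ hn s => ?_⟩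
  have hδ0 : 0 < δ := hε.trans_le hεδ
  have hε1 : ε ≤ 1 := hεδ.trans hδ
  have hn0 : 0 < (n : ℝ) := by
    rcases Nat.eq_zero_or_pos n with h | h
    · rw [h] at hn; norm_num at hn
    · exact_mod_cast h
  set f := localStatistic Ω Γ η γ α ε (testProfile s) with hf
  have hfB : ∀ x y, |f x y| ≤ B := fun x y =>
    abs_localStatistic_le hη hα hK0 hK hε (abs_testProfile_le s) x y
  have hfm : Measurable fun p : EuclideanSpace ℝ (Fin d) × EuclideanSpace ℝ (Fin d) =>
      f p.1 p.2 := measurable_localStatistic hΩ hη hγ hε (continuous_testProfile s).measurable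
  have hfV : ∀ x, ∫ y, f x y ^ 2 ∂(dataMeasure Ω ρ) ≤ V * ε ^ d := fun x => by
    have := abs_integral_dataMeasure_le hΩ hρ hL0.le (fun y hy => (hL y hy).2.1)
      (f := fun y => f x y ^ 2) (B := B ^ 2) (x := x) hε
      (fun y => by rw [abs_pow]; exact pow_le_pow_left₀ (abs_nonneg _) (hfB x y) 2)
      (fun y hy => by simp [hf, localStatistic_eq_zero hη hε _ hy])
    exact ((le_abs_self _).trans this).trans_eq (by rw [hV]; ring)
  -- The choice of l balances l²nVε^d against l·nδε^{d+1} up to constants. In k = 2V + 2B, the part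
  -- 2B ensures l·2B ≤ 1 and the part 2V keeps the quadratic term below half the linear one.
  have hdev := pi_real_exists_deviation_le (μ := dataMeasure Ω ρ) hfm hfB hfV
    (l := δ * ε / k) (by positivity) (by
      rw [div_mul_eq_mul_div, div_le_one hk0]
      calc δ * ε * (2 * B) ≤ 1 * 1 * (2 * B) := by gcongr
        _ ≤ k := by rw [hk]; linarith) n (n * (δ * ε ^ (d + 1)))
  refine (measureReal_mono ?_ (measure_ne_top _ _)).trans (hdev.trans ?_)
  · rintro x ⟨i, hi⟩
    refine ⟨i, ?_⟩
    set E := ∫ y, f (x i) y ∂(dataMeasure Ω ρ) with hE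
    have hEB : |E| ≤ B := by
      have := norm_integral_le_of_norm_le_const (μ := dataMeasure Ω ρ) (f := f (x i)) (C := B)
        (Filter.Eventually.of_forall (hfB (x i)))
      simpa using this
    have hsum : (n : ℝ)⁻¹ * ∑ j, f (x i) (x j) - E
        = (n : ℝ)⁻¹ * (∑ j ∈ Finset.univ.erase i, (f (x i) (x j) - E))
          + (n : ℝ)⁻¹ * (f (x i) (x i) - E) := by
      rw [← mul_add, Finset.sum_erase_add Finset.univ _ (Finset.mem_univ i),
        Finset.sum_sub_distrib, Finset.sum_const, Finset.card_univ, Fintype.card_fin, nsmul_eq_mul]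
      field_simp
    have hi' : (1 + 2 * B) * δ * ε ^ (d + 1) <
        |(n : ℝ)⁻¹ * ∑ j, f (x i) (x j) - E| := hi
    rw [hsum] at hi'
    -- The diagonal term is O(1/n), and δ²nε^{d+2} ≥ 1 implies 1/n ≤ δε^{d+1}.
    have h1 : |(n : ℝ)⁻¹ * (f (x i) (x i) - E)| ≤ 2 * B * (δ * ε ^ (d + 1)) := by
      have hninv : (n : ℝ)⁻¹ ≤ δ * ε ^ (d + 1) := by
        rw [inv_le_iff_one_le_mul₀ hn0]
        calc (1 : ℝ) ≤ δ ^ 2 * n * ε ^ (d + 2) := hn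
          _ = δ * ε ^ (d + 1) * n * (δ * ε) := by ring
          _ ≤ δ * ε ^ (d + 1) * n * (1 * 1) := by gcongr
          _ = _ := by ring
      rw [abs_mul, abs_of_pos (inv_pos.2 hn0), mul_comm]
      have h2 : |f (x i) (x i) - E| ≤ 2 * B := (abs_sub _ _).trans (by linarith [hfB (x i) (x i)])
      exact mul_le_mul h2 hninv (by positivity) (by positivity)
    have h3 := hi'.trans_le (abs_add_le _ _)
    rw [abs_mul, abs_of_pos (inv_pos.2 hn0)] at h3
    have h4 : δ * ε ^ (d + 1) ≤
        (n : ℝ)⁻¹ * |∑ j ∈ Finset.univ.erase i, (f (x i) (x j) - E)| := by linarith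
    rwa [← div_eq_inv_mul, le_div_iff₀ hn0, mul_comm] at h4
  · refine mul_le_mul_of_nonneg_left (Real.exp_le_exp.2 ?_) (by positivity)
    have e : (n : ℝ) * ((δ * ε / k) ^ 2 * (V * ε ^ d)) - δ * ε / k * (n * (δ * ε ^ (d + 1)))
        = (δ ^ 2 * n * ε ^ (d + 2)) * (V / k ^ 2 - 1 / k) := by
      field_simp
      ring
    have h1 : V / k ^ 2 - 1 / k ≤ -(1 / (2 * k)) := by
      have h2 : V / k ^ 2 ≤ 1 / (2 * k) := by
        rw [div_le_div_iff₀ (by positivity) (by positivity)]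
        nlinarith
      have h3 : 1 / k = 1 / (2 * k) + 1 / (2 * k) := by field_simp; norm_num
      linarith
    rw [e]
    calc _ ≤ (δ ^ 2 * n * ε ^ (d + 2)) * (-(1 / (2 * k))) := by gcongr
      _ = _ := by ring

theorem exists_measurable_consistencyHolds [NeZero d] (hΩ : IsOpen Ω)
    (hΩb : Bornology.IsBounded Ω)
    (hΓne : Γ.Nonempty) (hΓ : (Γ : Set (EuclideanSpace ℝ (Fin d))) ⊆ Ω) (hρ : IsDataDensity Ω ρ)
    (hη : IsKernelProfile η) (hr₀ : 0 < r₀) (hα : 0 ≤ α) (hγ : IsPenaltyWeight Ω Γ r₀ α γ) :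
    ∃ C c : ℝ, 0 < C ∧ 0 < c ∧ ∀ (n : ℕ) (ε δ : ℝ), 1 ≤ n → 0 < ε → ε ≤ δ → δ ≤ 1 →
      ∃ A : Set (Fin n → EuclideanSpace ℝ (Fin d)), MeasurableSet A ∧
        (∀ x ∈ A, ConsistencyHolds Ω Γ η γ ρ α C n ε δ x) ∧
        1 - C * Real.exp (-c * δ ^ 2 * n * ε ^ (d + 2) + Real.log n)
          ≤ (Measure.pi fun _ : Fin n => dataMeasure Ω ρ).real A := by
  have := hρ.isProbability
  obtain ⟨T, c, hT, hc, hdev⟩ := exists_const_deviation_le hΩ hΩb hΓne hΓ hρ hη hr₀ hα hγ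
  obtain ⟨C₁, hC₁, hcons⟩ := exists_const_consistencyHolds hΩ hΩb hΓne hΓ hρ hη hr₀ hα hγ hT
  set N : ℝ := (Fintype.card (Option (Fin d ⊕ Fin d × Fin d)) : ℝ) with hN
  -- C₁ serves the consistency estimate, 2N the two-sided union bound over N profiles, and e^c makes
  -- the claim trivial when δ²nε^{d+2} < 1.
  refine ⟨C₁ + 2 * N + Real.exp c, c, by positivity, hc, fun n ε δ hn hε hεδ hδ => ?_⟩
  have hn0 : (1 : ℝ) ≤ n := by exact_mod_cast hn
  have hδ0 : 0 < δ := hε.trans_le hεδ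
  set u := δ ^ 2 * n * ε ^ (d + 2) with hu
  have hexp : Real.exp (-c * δ ^ 2 * n * ε ^ (d + 2) + Real.log n) = n * Real.exp (-(c * u)) := by
    rw [Real.exp_add, Real.exp_log (by linarith), mul_comm, hu]
    congr 2; ring
  rw [hexp]
  rcases lt_or_ge u 1 with h1 | h1
  · refine ⟨∅, MeasurableSet.empty, by simp, ?_⟩
    rw [measureReal_empty, sub_nonpos]
    have h2 : Real.exp (-c) ≤ Real.exp (-(c * u)) := Real.exp_le_exp.2 (by nlinarith)
    calc (1 : ℝ) = Real.exp c * (1 * Real.exp (-c)) := by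
          rw [one_mul, ← Real.exp_add, add_neg_cancel, Real.exp_zero]
      _ ≤ (C₁ + 2 * N + Real.exp c) * (n * Real.exp (-(c * u))) := by
          gcongr
          have : 0 ≤ C₁ + 2 * N := by positivity
          linarith
  set P := Measure.pi fun _ : Fin n => dataMeasure Ω ρ with hP
  set bad : Option (Fin d ⊕ Fin d × Fin d) → Set (Fin n → EuclideanSpace ℝ (Fin d)) := fun s =>
    {x | ∃ i, T * δ * ε ^ (d + 1) <
          |(n : ℝ)⁻¹ * ∑ j, localStatistic Ω Γ η γ α ε (testProfile s) (x i) (x j)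
            - ∫ y, localStatistic Ω Γ η γ α ε (testProfile s) (x i) y ∂(dataMeasure Ω ρ)|}
    with hbad
  -- The non-generic configurations are enlarged to a measurable null set, so that the good event is
  -- measurable.
  obtain ⟨G, hGsub, hGm, hG0⟩ := exists_measurable_superset_of_null
    (ae_iff.1 (ae_pi_dataMeasure_generic hΩ hρ n (2 * ε)))
  have hbm : ∀ s, MeasurableSet (bad s) := fun s => by
    have hfm := measurable_localStatistic (α := α) hΩ hη hγ hε
      (continuous_testProfile s).measurable
    have hgm := (hfm.stronglyMeasurable.integral_prod_right' (ν := dataMeasure Ω ρ)).measurable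
    have e : bad s = ⋃ i, {x | T * δ * ε ^ (d + 1) <
          |(n : ℝ)⁻¹ * ∑ j, localStatistic Ω Γ η γ α ε (testProfile s) (x i) (x j)
            - ∫ y, localStatistic Ω Γ η γ α ε (testProfile s) (x i) y ∂(dataMeasure Ω ρ)|} := by
      ext x; simp [hbad]
    rw [e]
    refine MeasurableSet.iUnion fun i => measurableSet_lt measurable_const ?_
    refine Measurable.abs (Measurable.sub (Measurable.const_mul
      (Finset.measurable_sum _ fun j _ => ?_) _) (hgm.comp (measurable_pi_apply i)))
    exact hfm.comp (f := fun x : Fin n → EuclideanSpace ℝ (Fin d) => (x i, x j))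
      ((measurable_pi_apply i).prodMk (measurable_pi_apply j))
  have hbadm : MeasurableSet (G ∪ ⋃ s, bad s) := hGm.union (MeasurableSet.iUnion hbm)
  refine ⟨(G ∪ ⋃ s, bad s)ᶜ, hbadm.compl, fun x hx => ?_, ?_⟩
  · rw [mem_compl_iff, mem_union, not_or] at hx
    have hgen : Function.Injective x ∧ (∀ i j, i ≠ j → ‖x j - x i‖ ≠ 2 * ε) ∧ ∀ i, x i ∈ Ω := by
      by_contra h
      exact hx.1 (hGsub h)
    have hh := hcons n ε δ x hε hεδ hδ hgen.1 hgen.2.1 hgen.2.2 fun s i => by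
      by_contra h
      exact hx.2 (mem_iUnion.2 ⟨s, i, not_le.1 h⟩)
    intro i hi hnear hball φ hφ
    refine (hh i hi hnear hball φ hφ).trans (mul_le_mul_of_nonneg_right ?_ ?_)
    · have : 0 ≤ N := by positivity
      linarith [Real.exp_pos c]
    · have hM : 0 ≤ Metric.infDist (x i) Γ - 2 * ε := by linarith
      unfold consistencyError
      have := fun s : ℝ => Real.rpow_nonneg hM s
      have h1 := this (-(α + 2))
      have h2 := this (-(α + 1))
      have h3 := this (-α)
      positivity
  · rw [probReal_compl_eq_one_sub hbadm]
    have h2 : P.real (G ∪ ⋃ s, bad s) ≤ 2 * N * (n * Real.exp (-(c * u))) := by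
      calc P.real (G ∪ ⋃ s, bad s) ≤ P.real G + P.real (⋃ s, bad s) := measureReal_union_le _ _
        _ ≤ 0 + ∑ s, P.real (bad s) := by
            refine add_le_add (le_of_eq ?_) (measureReal_iUnion_fintype_le _)
            rw [Measure.real, hG0, ENNReal.toReal_zero]
        _ ≤ 0 + ∑ _s : Option (Fin d ⊕ Fin d × Fin d), 2 * n * Real.exp (-(c * u)) := by
            gcongr with s
            refine (hdev n ε δ hε hεδ hδ h1 s).trans_eq ?_
            rw [hu]; congr 2; ring
        _ = _ := by
            rw [Finset.sum_const, Finset.card_univ, nsmul_eq_mul, zero_add]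
            ring
    have h3 : 0 ≤ (C₁ + Real.exp c) * (n * Real.exp (-(c * u))) := by positivity
    linarith

end Probability

/-! ### Transfer to an arbitrary i.i.d. sample. -/

theorem mainTheorem4 (d : ℕ) [NeZero d] (Ω : Set (EuclideanSpace ℝ (Fin d)))
    (hΩ : IsOpen Ω) (hΩb : Bornology.IsBounded Ω)
    (Γ : Finset (EuclideanSpace ℝ (Fin d))) (hΓne : Γ.Nonempty)
    (hΓ : (Γ : Set (EuclideanSpace ℝ (Fin d))) ⊆ Ω)
    (ρ : EuclideanSpace ℝ (Fin d) → ℝ) (hρ : IsDataDensity Ω ρ)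
    (η : ℝ → ℝ) (hη : IsKernelProfile η)
    (r₀ α : ℝ) (hr₀ : 0 < r₀) (hα : 0 ≤ α)
    (γ : EuclideanSpace ℝ (Fin d) → ℝ) (hγ : IsPenaltyWeight Ω Γ r₀ α γ) :
    ∃ C c : ℝ, 0 < C ∧ 0 < c ∧
      ∀ (S : Type*) [MeasurableSpace S] (P : Measure S) [IsProbabilityMeasure P]
        (n : ℕ) (X : Fin n → S → EuclideanSpace ℝ (Fin d)),
        1 ≤ n → (∀ i, Measurable (X i)) → iIndepFun X P →
        (∀ i, P.map (X i) = dataMeasure Ω ρ) →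
        ∀ ε δ : ℝ, 0 < ε → ε ≤ δ → δ ≤ 1 →
          ∃ A : Set S, MeasurableSet A ∧
            A ⊆ {s | ConsistencyHolds Ω Γ η γ ρ α C n ε δ (fun i => X i s)} ∧
            1 - C * Real.exp (-c * δ ^ 2 * n * ε ^ (d + 2) + Real.log n) ≤ P.real A := by
  obtain ⟨C, c, hC, hc, h⟩ :=
    exists_measurable_consistencyHolds hΩ hΩb hΓne hΓ hρ hη hr₀ hα hγ
  refine ⟨C, c, hC, hc, fun S _ P _ n X hn hX hind hlaw ε δ hε hεδ hδ => ?_⟩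
  obtain ⟨A, hA, hsub, hle⟩ := h n ε δ hn hε hεδ hδ
  have hmeas : Measurable fun s i => X i s := measurable_pi_lambda _ hX
  -- Independence makes the joint law the product measure, so the event on the product space pulls
  -- back with its probability unchanged.
  have hmap : P.map (fun s i => X i s) = Measure.pi fun _ : Fin n => dataMeasure Ω ρ := by
    rw [hind.map_fun_eq_pi_map fun i => (hX i).aemeasurable]
    simp_rw [hlaw]
  refine ⟨(fun s i => X i s) ⁻¹' A, hmeas hA, fun s hs => hsub _ hs, ?_⟩
  rw [← hmap, map_measureReal_apply hmeas hA] at hle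
  exact hle
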